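/- Let $a,b,d$ be integers with $b>0$ such that the symmetric matrix $\begin{pmatrix}a&b\\b&d\end{pmatrix}$ is positive definite (so $a,d>0$ and $ad>b^2$). Consider the system $$1-x_1=x_1^a x_2^b,\qquad 1-x_2=x_1^b x_2^d .$$ The multiplicity of a solution $p\in\mathbb{R}^2$ is the intersection multiplicity at $p$ of the two complex plane curves defined by these equations, i.e. the length (equivalently, the dimension over $\mathbb{C}$) of $$\mathcal{O}_{p}/\bigl(1-x_1-x_1^a x_2^b,\;1-x_2-x_1^b x_2^d\bigr),$$ where $\mathcal{O}_{p}$ is the localization of $\mathbb{C}[x_1,x_2]$ at the maximal ideal of $p$. Then the system has only finitely many real solutions, and the sum of their multiplicities is at most $9$. Moreover, exactly one solution lies in $(0,1)^2$, and this solution has multiplicity $1$. -/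

import Mathlib

open MvPolynomial in
/-- The maximal ideal of `k[x₁, x₂]` of the polynomials vanishing at the point `p ∈ k²`. -/
noncomputable abbrev pointIdeal {k : Type*} [Field k] (p : Fin 2 → k) : Ideal (MvPolynomial (Fin 2) k) :=
  RingHom.ker (eval p : MvPolynomial (Fin 2) k →+* k)

instance pointIdeal_isPrime {k : Type*} [Field k] (p : Fin 2 → k) : (pointIdeal p).IsPrime :=
  RingHom.ker_isPrime _

/-- The local ring `𝒪_p` of the affine plane over the field `k` at the `k`-rational point `p`: the
localization of `k[x₁, x₂]` at the maximal ideal of the polynomials vanishing at `p`. -/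
abbrev PlaneLocalRing {k : Type*} [Field k] (p : Fin 2 → k) : Type _ :=
  Localization.AtPrime (pointIdeal p)

/-- The intersection multiplicity at `p` of the plane curves `f = 0` and `g = 0`: the length of
the `𝒪_p`-module `𝒪_p / (f, g)`. As the residue field is `k`, this is `dim_k 𝒪_p / (f, g)`; it is
`0` if `p` is not on both curves, and `⊤` if they share a component through `p`. -/
noncomputable def intersectionMultiplicity {k : Type*} [Field k] (f g : MvPolynomial (Fin 2) k)
    (p : Fin 2 → k) : ℕ∞ :=
  Module.length (PlaneLocalRing p)
    (PlaneLocalRing p ⧸ Ideal.span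
      {algebraMap (MvPolynomial (Fin 2) k) (PlaneLocalRing p) f,
        algebraMap (MvPolynomial (Fin 2) k) (PlaneLocalRing p) g})

/-- `(x₁, x₂)` is a real solution of `1 - x₁ = x₁ ^ a * x₂ ^ b`, `1 - x₂ = x₁ ^ b * x₂ ^ d`. -/
def IsNahmSolution (a b d : ℕ) (x : ℝ × ℝ) : Prop :=
  1 - x.1 = x.1 ^ a * x.2 ^ b ∧ 1 - x.2 = x.1 ^ b * x.2 ^ d

open MvPolynomial in
/-- The multiplicity of a real point as a solution of the system `1 - x₁ = x₁ ^ a * x₂ ^ b`,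
`1 - x₂ = x₁ ^ b * x₂ ^ d`: the intersection multiplicity at that point of the two complex plane
curves that the equations define. -/
noncomputable def nahmMultiplicity (a b d : ℕ) (x : ℝ × ℝ) : ℕ∞ :=
  intersectionMultiplicity (k := ℂ)
    (1 - X 0 - X 0 ^ a * X 1 ^ b) (1 - X 1 - X 0 ^ b * X 1 ^ d) ![(x.1 : ℂ), (x.2 : ℂ)]

/-! On the curve `1 - u = u ^ a * v ^ b` put s = u / (u - 1). Then log |u| = log |s| - log |1 - s|
and log |1 - u| = -log |1 - s|, so log |v| is the explicit function `nahmLog` of s. Once the sign of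
v is fixed, the second equation says that `nahmDefect` vanishes at s. Solutions in an open quadrant
thus become zeros on an interval, and Rolle's theorem with multiplicity (`ZerosBoundedBy.of_deriv`)
bounds them.

For u, v > 0 the derivative has no zero, which leaves at most 1 solution. For v < 0 it vanishes
where t = |v| / (1 + |v|) equals d - b² / (a - s). Comparing log (t / (1 - t)) on both sides gives
`nahmCritical`, whose derivative is rational. If u > 0 > v, the parity of b puts s outside [0, 1];
that derivative is then positive on the relevant window, and two uses of Rolle give at most 2. The
quadrant u < 0 < v is symmetric. If u, v < 0, then s is in (0, 1) and the numerator is a cubic; an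
integrality argument (`nahmCubic_not_three_roots`) excludes three roots in the window, so the bound
is 2 + 1 + 1 = 4. The total is 1 + 2 + 2 + 4 = 9.

As for multiplicities, the parametrised curve is smooth at every solution, with its parametrising
unknown as local coordinate. If the intersection has length at least m, the other equation lies in
(f, t^m) locally; restriction to the real branch shows that `nahmDefect` vanishes to order at least
m (`nahmDefect_isBigO`). Existence in the square is the intermediate value theorem, and the bound 1
gives uniqueness and simplicity. -/

open Filter Topology Asymptotics

/-! ### Zeros of real functions counted with multiplicity -/

/-- On `I` the function `f` has at most `n` zeros, counted with multiplicity. -/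
def ZerosBoundedBy (f : ℝ → ℝ) (I : Set ℝ) (n : ℕ) : Prop :=
  ∀ S : Finset ℝ, ↑S ⊆ I → ∀ m : ℝ → ℕ,
    (∀ x ∈ S, f =O[𝓝 x] fun y => (y - x) ^ m x) → ∑ x ∈ S, m x ≤ n

theorem eq_zero_of_mul_isBigO_sub_pow {g : ℝ → ℝ} {x : ℝ} (hg : ContinuousAt g x) {k m : ℕ}
    (hkm : k < m) (h : (fun y => (y - x) ^ k * g y) =O[𝓝 x] fun y => (y - x) ^ m) : g x = 0 := by
  obtain ⟨c, rfl⟩ := Nat.exists_eq_add_of_lt hkm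
  obtain ⟨K, hK⟩ := h.bound
  have hlim : Tendsto (fun y => K * |y - x| ^ (c + 1)) (𝓝[≠] x) (𝓝 0) := by
    have : Tendsto (fun y => K * |y - x| ^ (c + 1)) (𝓝 x) (𝓝 (K * |x - x| ^ (c + 1))) :=
      ContinuousAt.tendsto (by fun_prop)
    simpa using this.mono_left nhdsWithin_le_nhds
  have hle : ∀ᶠ y in 𝓝[≠] x, |g y| ≤ K * |y - x| ^ (c + 1) := by
    filter_upwards [hK.filter_mono nhdsWithin_le_nhds, self_mem_nhdsWithin] with y hy hne
    have hpos : 0 < |y - x| ^ k := pow_pos (abs_pos.2 (sub_ne_zero.2 hne)) k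
    simp only [norm_mul, norm_pow, Real.norm_eq_abs] at hy
    rw [add_assoc, pow_add] at hy
    nlinarith
  have h0 : Tendsto (fun y => |g y|) (𝓝[≠] x) (𝓝 0) :=
    squeeze_zero' (Eventually.of_forall fun y => abs_nonneg _) hle hlim
  have h1 : Tendsto (fun y => |g y|) (𝓝[≠] x) (𝓝 |g x|) :=
    (hg.abs.tendsto).mono_left nhdsWithin_le_nhds
  exact abs_eq_zero.1 (tendsto_nhds_unique h1 h0)

theorem le_analyticOrderAt_of_isBigO {f : ℝ → ℝ} {x : ℝ} (hf : AnalyticAt ℝ f x) {m : ℕ}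
    (h : f =O[𝓝 x] fun y => (y - x) ^ m) : (m : ℕ∞) ≤ analyticOrderAt f x := by
  by_contra! hlt
  obtain ⟨n, hn⟩ := ENat.ne_top_iff_exists.1 hlt.ne_top
  obtain ⟨g, hg, hgx, hfg⟩ := hf.analyticOrderAt_eq_natCast.1 hn.symm
  rw [← hn] at hlt
  refine hgx (eq_zero_of_mul_isBigO_sub_pow hg.continuousAt (Nat.cast_lt.1 hlt) (.trans ?_ h))
  exact EventuallyEq.isBigO (hfg.mono fun y hy => by simp [hy])

theorem isBigO_of_le_analyticOrderAt {f : ℝ → ℝ} {x : ℝ} (hf : AnalyticAt ℝ f x) {m : ℕ}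
    (h : (m : ℕ∞) ≤ analyticOrderAt f x) : f =O[𝓝 x] fun y => (y - x) ^ m := by
  obtain ⟨g, hg, hfg⟩ := (natCast_le_analyticOrderAt hf).1 h
  refine (EventuallyEq.isBigO hfg).trans ?_
  simpa using (isBigO_refl (fun y : ℝ => (y - x) ^ m) (𝓝 x)).mul
    (hg.continuousAt.isBigO_one ℝ)

theorem eq_zero_of_isBigO_sub_pow {f : ℝ → ℝ} {x : ℝ} {m : ℕ} (hm : m ≠ 0)
    (h : f =O[𝓝 x] fun y => (y - x) ^ m) : f x = 0 := by
  obtain ⟨K, hK⟩ := h.bound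
  simpa [hm] using hK.self_of_nhds

theorem deriv_isBigO_sub_pow {f : ℝ → ℝ} {x : ℝ} (hf : AnalyticAt ℝ f x) {m : ℕ}
    (h : f =O[𝓝 x] fun y => (y - x) ^ (m + 1)) : deriv f =O[𝓝 x] fun y => (y - x) ^ m := by
  refine isBigO_of_le_analyticOrderAt hf.deriv ?_
  have h1 := le_analyticOrderAt_of_isBigO hf h
  have h2 := hf.analyticOrderAt_deriv_add_one
  rw [eq_zero_of_isBigO_sub_pow m.succ_ne_zero h] at h2
  simp only [sub_zero] at h2
  rw [← h2] at h1
  push_cast at h1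
  exact (ENat.add_le_add_iff_right ENat.one_ne_top).1 h1

/-- Points of weight 0 need not be zeros of `f`; they contribute nothing and may be dropped. -/
theorem ZerosBoundedBy.of_forall_pos {f : ℝ → ℝ} {I : Set ℝ} {n : ℕ}
    (h : ∀ S : Finset ℝ, ↑S ⊆ I → ∀ m : ℝ → ℕ, (∀ x ∈ S, m x ≠ 0) →
      (∀ x ∈ S, f =O[𝓝 x] fun y => (y - x) ^ m x) → ∑ x ∈ S, m x ≤ n) : ZerosBoundedBy f I n := by
  intro S hS m hm
  rw [← Finset.sum_filter_ne_zero]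
  exact h _ (fun x hx => hS (Finset.filter_subset _ _ hx)) m
    (fun x hx => (Finset.mem_filter.1 hx).2) fun x hx => hm x (Finset.mem_filter.1 hx).1

/-- Zeros of `f` on `I` transfer, with multiplicity, to zeros of `g` on `J`. -/
theorem ZerosBoundedBy.of_isBigO {f g : ℝ → ℝ} {I J : Set ℝ} {n : ℕ} (hg : ZerosBoundedBy g J n)
    (h : ∀ x ∈ I, f x = 0 → x ∈ J ∧
      ∀ m : ℕ, (f =O[𝓝 x] fun y => (y - x) ^ m) → g =O[𝓝 x] fun y => (y - x) ^ m) :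
    ZerosBoundedBy f I n :=
  .of_forall_pos fun S hS m hm0 hm => hg S
    (fun x hx => (h x (hS hx) (eq_zero_of_isBigO_sub_pow (hm0 x hx) (hm x hx))).1) m
    fun x hx => (h x (hS hx) (eq_zero_of_isBigO_sub_pow (hm0 x hx) (hm x hx))).2 _ (hm x hx)

theorem zerosBoundedBy_zero {f : ℝ → ℝ} {I : Set ℝ} (h : ∀ x ∈ I, f x ≠ 0) :
    ZerosBoundedBy f I 0 :=
  .of_forall_pos fun S hS m hm0 hm => by
    rw [nonpos_iff_eq_zero, Finset.sum_eq_zero_iff]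
    exact fun x hx => absurd (eq_zero_of_isBigO_sub_pow (hm0 x hx) (hm x hx)) (h x (hS hx))

/-- Rolle's theorem, counting zeros with multiplicity. -/
theorem ZerosBoundedBy.of_deriv {f : ℝ → ℝ} {I : Set ℝ} {n : ℕ} (hI : I.OrdConnected)
    (hf : ∀ x ∈ I, AnalyticAt ℝ f x) (h : ZerosBoundedBy (deriv f) I n) :
    ZerosBoundedBy f I (n + 1) := by
  refine .of_forall_pos fun S hS m hm0 hm => ?_
  have hz : ∀ x ∈ S, f x = 0 := fun x hx => eq_zero_of_isBigO_sub_pow (hm0 x hx) (hm x hx)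
  have hr : ∀ p : ℝ × ℝ, ∃ z, p.1 ∈ S → p.2 ∈ S → p.1 < p.2 →
      z ∈ Set.Ioo p.1 p.2 ∧ deriv f z = 0 := by
    rintro ⟨x, y⟩
    by_cases hxy : x ∈ S ∧ y ∈ S ∧ x < y
    · obtain ⟨hx, hy, hlt⟩ := hxy
      obtain ⟨z, hzm, hz0⟩ := exists_deriv_eq_zero hlt
        (fun z hz => (hf z (hI.out (hS hx) (hS hy) hz)).continuousAt.continuousWithinAt)
        ((hz x hx).trans (hz y hy).symm)
      exact ⟨z, fun _ _ _ => ⟨hzm, hz0⟩⟩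
    · exact ⟨0, fun h1 h2 h3 => absurd ⟨h1, h2, h3⟩ hxy⟩
  choose z hz' using hr
  set T : Finset ℝ := ((S ×ˢ S).filter fun p => p.1 < p.2).image z with hT
  have hTmem : ∀ t ∈ T, t ∈ I ∧ deriv f t = 0 := by
    intro t ht
    obtain ⟨p, hp, rfl⟩ := Finset.mem_image.1 ht
    obtain ⟨hp, hlt⟩ := Finset.mem_filter.1 hp
    obtain ⟨h1, h2⟩ := Finset.mem_product.1 hp
    obtain ⟨hmem, h0⟩ := hz' p h1 h2 hlt
    exact ⟨hI.out (hS h1) (hS h2) (Set.Ioo_subset_Icc_self hmem), h0⟩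
  -- The Rolle point between two consecutive elements of `S` is not in `S`.
  have hcard : S.card ≤ (T \ S).card + 1 := by
    refine Finset.card_le_sdiff_of_interleaved fun x hx y hy hlt _ => ?_
    have := (hz' (x, y) hx hy hlt).1
    exact ⟨z (x, y), Finset.mem_image_of_mem _ (by simp [hx, hy, hlt]), this.1, this.2⟩
  -- Each zero keeps its multiplicity minus one, and each new Rolle point counts once; the new
  -- points make up for the lost units except one.
  have key := h (S ∪ (T \ S)) (fun x hx => by
      rcases Finset.mem_union.1 hx with hx | hx
      · exact hS hx
      · exact (hTmem x (Finset.mem_sdiff.1 hx).1).1) (fun x => if x ∈ S then m x - 1 else 1)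
    (fun x hx => by
      by_cases hxS : x ∈ S
      · simp only [hxS, if_true]
        refine deriv_isBigO_sub_pow (hf x (hS hxS)) ?_
        rw [Nat.sub_add_cancel (Nat.one_le_iff_ne_zero.2 (hm0 x hxS))]
        exact hm x hxS
      · simp only [hxS, if_false]
        have hxT := hTmem x (Finset.mem_sdiff.1 ((Finset.mem_union.1 hx).resolve_left hxS)).1
        have := (hf x hxT.1).deriv.differentiableAt.isBigO_sub
        simpa [hxT.2] using this)
  rw [Finset.sum_union Finset.disjoint_sdiff, Finset.sum_congr rfl fun x hx => if_pos hx,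
    Finset.sum_congr (s₁ := T \ S) rfl fun x hx => if_neg (Finset.mem_sdiff.1 hx).2] at key
  have hsum : ∑ x ∈ S, m x = ∑ x ∈ S, (m x - 1) + S.card := by
    rw [Finset.card_eq_sum_ones, ← Finset.sum_add_distrib]
    exact Finset.sum_congr rfl fun x hx => by have := hm0 x hx; omega
  simp only [Finset.sum_const, smul_eq_mul, mul_one] at key
  omega

open Polynomial in
theorem le_rootMultiplicity_of_isBigO {P : ℝ[X]} (hP : P ≠ 0) {x : ℝ} {m : ℕ}
    (h : (fun y => P.eval y) =O[𝓝 x] fun y => (y - x) ^ m) : m ≤ P.rootMultiplicity x := by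
  by_contra! hlt
  have hfac := P.pow_mul_divByMonic_rootMultiplicity_eq x
  refine eval_divByMonic_pow_rootMultiplicity_ne_zero x hP
    (eq_zero_of_mul_isBigO_sub_pow (g := fun y => (P /ₘ (X - C x) ^ P.rootMultiplicity x).eval y)
      (Polynomial.continuous _).continuousAt hlt ?_)
  refine (EventuallyEq.isBigO (.of_forall fun y => ?_)).trans h
  conv_rhs => rw [← hfac]
  simp

open Polynomial in
theorem zerosBoundedBy_eval {P : ℝ[X]} (hP : P ≠ 0) (I : Set ℝ) [DecidablePred (· ∈ I)] :
    ZerosBoundedBy (fun y => P.eval y) I (P.roots.filter (· ∈ I)).card := by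
  intro S hS m hm
  calc ∑ x ∈ S, m x ≤ ∑ x ∈ S, (P.roots.filter (· ∈ I)).count x :=
        Finset.sum_le_sum fun x hx => by
          rw [Multiset.count_filter_of_pos (hS hx), count_roots]
          exact le_rootMultiplicity_of_isBigO hP (hm x hx)
    _ ≤ _ := by
      classical
      rw [← Multiset.toFinset_sum_count_eq (P.roots.filter (· ∈ I))]
      refine Finset.sum_le_sum_of_ne_zero fun x _ hx => ?_
      simpa [Multiset.count_eq_zero, and_assoc] using hx

/-! ### Intersection multiplicity along a smooth curve -/

section Algebra

theorem Module.length_quotient_le_of_le {R : Type*} [CommRing R] {I J : Ideal R} (h : I ≤ J) :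
    Module.length R (R ⧸ J) ≤ Module.length R (R ⧸ I) :=
  Module.length_le_of_surjective (Submodule.factor h) (Submodule.factor_surjective h)

/-- The kernel of R/(f, t^(j+1)) → R/(f, t^j) is generated by the class of t^j, which the maximal
ideal kills; so each step adds at most 1 to the length. -/
theorem Module.length_quotient_span_pair_pow_le {R : Type*} [CommRing R] [IsLocalRing R] {f t : R}
    (hmax : IsLocalRing.maximalIdeal R ≤ Ideal.span {f, t}) (j : ℕ) :
    Module.length R (R ⧸ Ideal.span {f, t ^ j}) ≤ j := by
  induction j with
  | zero =>
    have : Ideal.span {f, t ^ 0} = (⊤ : Ideal R) :=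
      Ideal.eq_top_of_isUnit_mem _ (Ideal.subset_span (by simp)) isUnit_one
    rw [this, Nat.cast_zero, nonpos_iff_eq_zero, Module.length_eq_zero_iff]
    exact Submodule.Quotient.subsingleton_iff.2 rfl
  | succ j ih =>
    set I := Ideal.span {f, t ^ (j + 1)} with hI
    set J := Ideal.span {f, t ^ j} with hJ
    have hf : f ∈ I := Ideal.subset_span (by simp)
    have ht : t ^ (j + 1) ∈ I := Ideal.subset_span (by simp)
    have hIJ : I ≤ J := Ideal.span_le.2 <| by
      rintro x (rfl | rfl)
      · exact Ideal.subset_span (by simp)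
      · exact pow_succ t j ▸ J.mul_mem_right _ (Ideal.subset_span (by simp))
    let q : (R ⧸ I) →ₗ[R] R ⧸ J := Submodule.factor hIJ
    have hq : Function.Surjective q := Submodule.factor_surjective hIJ
    let φ : R →ₗ[R] R ⧸ I := LinearMap.toSpanSingleton R _ (I.mkQ (t ^ j))
    have hφ : ∀ r, φ r = I.mkQ (r * t ^ j) := fun r => by
      rw [← smul_eq_mul, map_smul, LinearMap.toSpanSingleton_apply]
    have hker : IsLocalRing.maximalIdeal R ≤ LinearMap.ker φ := fun r hr => by
      obtain ⟨α, β, rfl⟩ := Ideal.mem_span_pair.1 (hmax hr)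
      rw [LinearMap.mem_ker, hφ, Submodule.mkQ_apply, Submodule.Quotient.mk_eq_zero]
      have : (α * f + β * t) * t ^ j = (α * t ^ j) * f + β * t ^ (j + 1) := by ring
      rw [this]
      exact I.add_mem (I.mul_mem_left _ hf) (I.mul_mem_left _ ht)
    have hrange : LinearMap.ker q ≤ LinearMap.range φ := fun x hx => by
      obtain ⟨r, rfl⟩ := I.mkQ_surjective x
      have hr : r ∈ J := by
        exact (Submodule.Quotient.mk_eq_zero J).1 hx
      obtain ⟨α, β, rfl⟩ := Ideal.mem_span_pair.1 hr
      refine ⟨β, ?_⟩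
      rw [hφ, map_add, right_eq_add, Submodule.mkQ_apply, Submodule.Quotient.mk_eq_zero]
      exact I.mul_mem_left _ hf
    have hsimple : IsSimpleModule R (R ⧸ IsLocalRing.maximalIdeal R) :=
      isSimpleModule_iff_isCoatom.2 (IsLocalRing.maximalIdeal.isMaximal R).out
    have hlen : Module.length R (LinearMap.ker q) ≤ 1 := by
      refine (Module.length_le_of_injective (Submodule.inclusion hrange)
        (Submodule.inclusion_injective _)).trans ?_
      rw [← Module.length_eq_one R (R ⧸ IsLocalRing.maximalIdeal R)]
      refine Module.length_le_of_surjective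
        ((IsLocalRing.maximalIdeal R).liftQ φ.rangeRestrict (by simpa using hker)) ?_
      rw [← LinearMap.range_eq_top, Submodule.range_liftQ, LinearMap.range_rangeRestrict]
    rw [Module.length_eq_add_of_exact (LinearMap.ker q).subtype q (Submodule.subtype_injective _)
      hq (LinearMap.exact_subtype_ker_map q), Nat.cast_add, Nat.cast_one, add_comm]
    exact add_le_add ih hlen

/-- If the curve `f = 0` is smooth with local parameter `t`, then `g` vanishes along it at least to
the order given by the length of the intersection with `g = 0`. -/
theorem Ideal.mem_span_pair_pow_of_le_length {R : Type*} [CommRing R] [IsLocalRing R] {f g t : R}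
    (hmax : IsLocalRing.maximalIdeal R ≤ Ideal.span {f, t}) {m : ℕ}
    (hm : (m : ℕ∞) ≤ Module.length R (R ⧸ Ideal.span {f, g})) : g ∈ Ideal.span {f, t ^ m} := by
  induction m with
  | zero =>
    have : Ideal.span {f, t ^ 0} = (⊤ : Ideal R) :=
      Ideal.eq_top_of_isUnit_mem _ (Ideal.subset_span (by simp)) isUnit_one
    exact this ▸ trivial
  | succ j ih =>
    obtain ⟨α, β, hg⟩ := Ideal.mem_span_pair.1 (ih (le_trans (by norm_cast; omega) hm))
    -- If β is a unit, then t^j lies in (f, g) and the length is at most j, too small. Otherwise β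
    -- lies in (f, t), which supplies one more factor t.
    by_cases hβ : IsUnit β
    · exfalso
      have hle : Ideal.span {f, t ^ j} ≤ Ideal.span {f, g} := Ideal.span_le.2 <| by
        rintro x (rfl | rfl)
        · exact Ideal.subset_span (by simp)
        · refine (Ideal.unit_mul_mem_iff_mem _ hβ).1 (Ideal.mem_span_pair.2 ⟨-α, 1, ?_⟩)
          rw [← hg]; ring
      have := hm.trans ((Module.length_quotient_le_of_le hle).trans
        (Module.length_quotient_span_pair_pow_le hmax j))
      norm_cast at this
      omega
    · obtain ⟨γ, δ, hβ⟩ := Ideal.mem_span_pair.1 (hmax ((IsLocalRing.mem_maximalIdeal β).2 hβ))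
      exact Ideal.mem_span_pair.2 ⟨α + γ * t ^ j, δ, by rw [← hg, ← hβ]; ring⟩

theorem Localization.AtPrime.exists_mul_eq_of_mem_span_pair {A : Type*} [CommRing A] (P : Ideal A)
    [P.IsPrime] {f g t : A}
    (h : algebraMap A (Localization.AtPrime P) g ∈
      Ideal.span {algebraMap A (Localization.AtPrime P) f, algebraMap A (Localization.AtPrime P) t}) :
    ∃ c ∉ P, ∃ α β, c * g = α * f + β * t := by
  rw [← Set.image_pair, ← Ideal.map_span,
    IsLocalization.mem_map_algebraMap_iff P.primeCompl] at h
  obtain ⟨⟨⟨y, hy⟩, s⟩, h⟩ := h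
  rw [← map_mul] at h
  obtain ⟨c, hc⟩ := (IsLocalization.eq_iff_exists P.primeCompl _).1 h
  obtain ⟨α, β, rfl⟩ := Ideal.mem_span_pair.1 hy
  exact ⟨c * s, (c * s).2, c * α, c * β, by simp only at hc; linear_combination hc⟩

open MvPolynomial in
theorem MvPolynomial.sub_C_eval_mem {σ k : Type*} [Field k] (p : σ → k) {I : Ideal (MvPolynomial σ k)}
    (hI : ∀ i, X i - C (p i) ∈ I) (q : MvPolynomial σ k) : q - C (eval p q) ∈ I := by
  induction q using MvPolynomial.induction_on with
  | C a => simp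
  | add q r hq hr =>
    have := I.add_mem hq hr
    rw [map_add, map_add]
    convert this using 1; ring
  | mul_X q i hq =>
    have := I.add_mem (I.mul_mem_right (X i) hq) (I.mul_mem_left (C (eval p q)) (hI i))
    rw [map_mul, map_mul, eval_X]
    convert this using 1; ring

open MvPolynomial in
/-- The polynomial `1 - x_i - x_i ^ a * x_j ^ b`. -/
noncomputable def nahmPolynomial (i j : Fin 2) (a b : ℕ) : MvPolynomial (Fin 2) ℂ :=
  1 - X i - X i ^ a * X j ^ b

open MvPolynomial in
-- The derivative in x_j at p is -b p_i^a p_j^(b-1) ≠ 0, so the curve is smooth there with local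
-- parameter x_i - p_i.
theorem maximalIdeal_le_span_nahmPolynomial {i j : Fin 2} (hij : i ≠ j) {a b : ℕ} (hb : 0 < b)
    {p : Fin 2 → ℂ} (hi : p i ≠ 0) (hj : p j ≠ 0) (hp : eval p (nahmPolynomial i j a b) = 0) :
    IsLocalRing.maximalIdeal (PlaneLocalRing p) ≤
      Ideal.span {algebraMap _ (PlaneLocalRing p) (nahmPolynomial i j a b),
        algebraMap _ (PlaneLocalRing p) (X i - C (p i))} := by
  set I := Ideal.span {algebraMap _ (PlaneLocalRing p) (nahmPolynomial i j a b),
        algebraMap _ (PlaneLocalRing p) (X i - C (p i))} with hI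
  have hf : algebraMap _ (PlaneLocalRing p) (nahmPolynomial i j a b) ∈ I :=
    Ideal.subset_span (by simp)
  have ht : algebraMap _ (PlaneLocalRing p) (X i - C (p i)) ∈ I := Ideal.subset_span (by simp)
  have hp' : 1 - p i - p i ^ a * p j ^ b = 0 := by simpa [nahmPolynomial] using hp
  obtain ⟨r, hr⟩ := sub_dvd_pow_sub_pow (X i : MvPolynomial (Fin 2) ℂ) (C (p i)) a
  -- Modulo x_i - p_i, the polynomial is -w (x_j - p_j), and w(p) = b p_i^a p_j^(b-1) makes w a unit
  -- in the local ring.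
  set w : MvPolynomial (Fin 2) ℂ :=
    C (p i) ^ a * ∑ l ∈ Finset.range b, X j ^ l * C (p j) ^ (b - 1 - l) with hw
  have hw0 : w ∈ (pointIdeal p).primeCompl := by
    intro h
    have : eval p w = 0 := h
    simp only [hw, map_mul, map_pow, eval_C, map_sum, eval_X] at this
    rw [Finset.sum_congr rfl (g := fun _ => p j ^ (b - 1)) fun l hl => by
      rw [← pow_add]; congr 1; have := Finset.mem_range.1 hl; omega] at this
    simp [hi, hj, hb.ne'] at this
  have hgeom := (Commute.all (X j : MvPolynomial (Fin 2) ℂ) (C (p j))).geom_sum₂_mul b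
  have hkey : w * (X j - C (p j)) =
      -(nahmPolynomial i j a b) - (1 + r * X j ^ b) * (X i - C (p i)) := by
    have hC : (1 : MvPolynomial (Fin 2) ℂ) - C (p i) - C (p i) ^ a * C (p j) ^ b = 0 := by
      simpa using congrArg (C (σ := Fin 2)) hp'
    rw [hw, nahmPolynomial]
    linear_combination C (p i) ^ a * hgeom + hC - X j ^ b * hr
  have hX : ∀ l, X l - C (p l) ∈ I.comap (algebraMap _ (PlaneLocalRing p)) := by
    intro l
    rw [Ideal.mem_comap]
    by_cases hl : l = i
    · exact hl ▸ ht
    · have : l = j := by omega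
      subst this
      refine (Ideal.unit_mul_mem_iff_mem _
        (IsLocalization.map_units (PlaneLocalRing p) ⟨w, hw0⟩)).1 ?_
      rw [← map_mul, hkey, map_sub, map_neg, map_mul]
      exact I.sub_mem (I.neg_mem hf) (I.mul_mem_left _ ht)
  rw [← Localization.AtPrime.map_eq_maximalIdeal, Ideal.map_le_iff_le_comap]
  intro q hq
  have hq0 : eval p q = 0 := hq
  simpa [hq0] using MvPolynomial.sub_C_eval_mem p hX q

end Algebra

open MvPolynomial in
/-- A real analytic bound for the intersection multiplicity: along a real path `γ` through `p` on
the curve `1 - x_i = x_i ^ a * x_j ^ b`, the function `g` vanishes to order at least the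
intersection multiplicity. -/
theorem eval_isBigO_of_le_intersectionMultiplicity {i j : Fin 2} (hij : i ≠ j) {a b : ℕ} (hb : 0 < b)
    {p : Fin 2 → ℂ} (hi : p i ≠ 0) (hj : p j ≠ 0) {g : MvPolynomial (Fin 2) ℂ} {m : ℕ}
    (hm : (m : ℕ∞) ≤ intersectionMultiplicity (nahmPolynomial i j a b) g p)
    {γ : ℝ → Fin 2 → ℂ} {s : ℝ} (hγ : ContinuousAt γ s) (hγs : γ s = p)
    (hfγ : ∀ᶠ x in 𝓝 s, eval (γ x) (nahmPolynomial i j a b) = 0) :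
    (fun x => eval (γ x) g) =O[𝓝 s] fun x => (γ x i - p i) ^ m := by
  have hp : eval p (nahmPolynomial i j a b) = 0 := hγs ▸ hfγ.self_of_nhds
  have hmem := Ideal.mem_span_pair_pow_of_le_length
    (maximalIdeal_le_span_nahmPolynomial hij hb hi hj hp) hm
  rw [← map_pow] at hmem
  -- Denominators are cleared by c with c(p) ≠ 0. On the path f vanishes, so g is β / c, which is
  -- bounded near s, times the m-th power.
  obtain ⟨c, hc, α, β, h⟩ := Localization.AtPrime.exists_mul_eq_of_mem_span_pair _ hmem
  have hcont : ∀ q : MvPolynomial (Fin 2) ℂ, Tendsto (fun x => eval (γ x) q) (𝓝 s) (𝓝 (eval p q)) := by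
    intro q
    have := (MvPolynomial.continuous_eval q).continuousAt.comp hγ
    simpa [ContinuousAt, Function.comp_def, hγs] using this
  have hc0 : eval p c ≠ 0 := hc
  have hev : (fun x => eval (γ x) g) =ᶠ[𝓝 s]
      fun x => ((eval (γ x) c)⁻¹ * eval (γ x) β) * (γ x i - p i) ^ m := by
    filter_upwards [hfγ, (hcont c).eventually_ne hc0] with x hx hcx
    have := congrArg (eval (γ x)) h
    simp only [map_mul, map_add, map_pow, map_sub, hx, eval_X, eval_C] at this
    field_simp
    linear_combination this
  refine hev.isBigO.trans ?_
  simpa using ((((hcont c).inv₀ hc0).mul (hcont β)).isBigO_one ℂ).mul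
    (isBigO_refl (fun x => (γ x i - p i) ^ m) (𝓝 s))

theorem Real.analyticAt_log_of_ne_zero {x : ℝ} (hx : x ≠ 0) : AnalyticAt ℝ Real.log x := by
  rcases hx.lt_or_gt with h | h
  · have h1 : AnalyticAt ℝ (fun y : ℝ => Real.log (-y)) x :=
      (analyticAt_id.neg).log (by simpa using h)
    simpa [Real.log_neg_eq_log] using h1
  · exact _root_.analyticAt_log h

/-! ### Roots of the critical cubic -/

/-- Since A - k < D - 1, the first inequality gives A k < D. Integrality gives k ≥ 1, hence A < D,
and allows k to be replaced by 1: A (D - 1)² < D (A - 1)². But the difference of these two sides is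
(D - A)(A D - 1) > 0. -/
theorem not_mul_mul_sq_lt {A D k : ℤ} (hlt : A * k * (D - 1) ^ 2 < D * (A - k) ^ 2)
    (hAk : 0 < A * k) (hAk_sub : 0 < A - k) (hDA : D * A - k < (D - 1) * (A + 1))
    (hk : 0 ≤ k) : False := by
  have hk_pos : 0 < k := hk.lt_of_ne (by rintro rfl; simp at hAk)
  have hA_pos : 0 < A := pos_of_mul_pos_left hAk hk
  have hsub_lt : A - k < D - 1 := by linarith
  have hAk_lt : A * k < D := by
    have h3 : (A - k) ^ 2 < (D - 1) ^ 2 := pow_lt_pow_left₀ hsub_lt hAk_sub.le two_ne_zero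
    have h4 : D * (A - k) ^ 2 < D * (D - 1) ^ 2 := mul_lt_mul_of_pos_left h3 (by linarith)
    exact lt_of_mul_lt_mul_right (hlt.trans h4) (sq_nonneg _)
  have hA_le : A ≤ A * k := le_mul_of_one_le_right hA_pos.le hk_pos
  have hsq_lt : A * (D - 1) ^ 2 < D * (A - 1) ^ 2 := by
    have h3 : (A - k) ^ 2 ≤ (A - 1) ^ 2 := pow_le_pow_left₀ hAk_sub.le (by linarith) 2
    have h4 : A * (D - 1) ^ 2 ≤ A * k * (D - 1) ^ 2 := mul_le_mul_of_nonneg_right hA_le (sq_nonneg _)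
    have h5 : D * (A - k) ^ 2 ≤ D * (A - 1) ^ 2 := mul_le_mul_of_nonneg_left h3 (by linarith)
    linarith
  have h6 : 0 < A * D - 1 := by
    have : D ≤ A * D := le_mul_of_one_le_left (by linarith) hA_pos
    linarith
  have hfactor : 0 < (D - A) * (A * D - 1) := mul_pos (by linarith) h6
  linarith

/-- The critical polynomial with three roots in the window cut out by `0 < s < 1` and
`(d - 1) * (a - s) < b ^ 2 < d * (a - s)` cannot exist. -/
theorem nahmCubic_not_three_roots {a b d : ℕ} (hb : 0 < b) (hd : 0 < d) (had : b ^ 2 < a * d)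
    {q s₁ s₂ s₃ : ℝ}
    (hs : ∀ s ∈ ({s₁, s₂, s₃} : Set ℝ), 0 < s ∧ s < 1 ∧ (b : ℝ) ^ 2 < d * (a - s) ∧
      ((d : ℝ) - 1) * (a - s) < b ^ 2)
    (hP : ∀ s : ℝ, (a - s) * (d * (a - s) - b ^ 2) * (b ^ 2 - (d - 1) * (a - s)) +
      b ^ 3 * (s * (s - 1)) = q * ((s - s₁) * (s - s₂) * (s - s₃))) : False := by
  obtain ⟨h1p, h1l, h1d, h1e⟩ := hs s₁ (by simp)
  obtain ⟨h2p, h2l, h2d, h2e⟩ := hs s₂ (by simp)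
  obtain ⟨h3p, h3l, h3d, h3e⟩ := hs s₃ (by simp)
  have hb' : (0 : ℝ) < b := by exact_mod_cast hb
  have hd' : (0 : ℝ) < d := by exact_mod_cast hd
  have had' : (b : ℝ) ^ 2 < a * d := by exact_mod_cast had
  have ha' : (0 : ℝ) < a := by
    have : 0 < a := by rcases a.eq_zero_or_pos with rfl | h <;> simp_all
    exact_mod_cast this
  -- A third finite difference reads off the leading coefficient.
  have hq : q = d * (d - 1) := by
    linear_combination (-1 / 6) * hP 3 + (1 / 2) * hP 2 - (1 / 2) * hP 1 + (1 / 6) * hP 0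
  subst hq
  -- For d = 1 the right side is zero, while the left is a quadratic with leading coefficient b² +
  -- b³.
  rcases (Nat.succ_le_iff.2 hd).eq_or_lt with rfl | hd2
  · have := hP 2
    have h1 := hP 1
    have h0 := hP 0
    push_cast at *
    have : (b : ℝ) ^ 2 + b ^ 3 = 0 := by
      linear_combination (1 / 2) * this - h1 + (1 / 2) * h0
    have : 0 < (b : ℝ) ^ 2 + b ^ 3 := by positivity
    linarith
  have hd2' : (1 : ℝ) < d := by exact_mod_cast hd2
  have hc : (0 : ℝ) < d * (d - 1) := mul_pos hd' (by linarith)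
  -- Here a - b²/d lies in (0, 1) and to the right of all three roots. The cubic should be positive
  -- there, but only b³ s (s - 1) < 0 survives.
  by_cases hA : (d : ℝ) * (a - 1) < b ^ 2
  · have hx := hP (a - b ^ 2 / d)
    have e : (d : ℝ) * (a - (a - b ^ 2 / d)) = b ^ 2 := by field_simp; ring
    rw [e] at hx
    have hl : ∀ s : ℝ, (b : ℝ) ^ 2 < d * (a - s) → 0 < a - b ^ 2 / d - s := fun s h => by
      have : (b : ℝ) ^ 2 / d < a - s := by rw [div_lt_iff₀ hd']; linarith
      linarith
    have hs0 : 0 < (a : ℝ) - b ^ 2 / d := by simpa using hl 0 (by linarith)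
    have hs1 : (a : ℝ) - b ^ 2 / d - 1 < 0 := by
      have : (a : ℝ) - 1 < b ^ 2 / d := by rw [lt_div_iff₀ hd']; linarith
      linarith
    have hpos := mul_pos hc (mul_pos (mul_pos (hl _ h1d) (hl _ h2d)) (hl _ h3d))
    have hneg := mul_neg_of_pos_of_neg (pow_pos hb' 3) (mul_neg_of_pos_of_neg hs0 hs1)
    linarith
  push Not at hA
  -- Here the value at 0 is nonnegative, yet three positive roots would make it negative.
  by_cases hB : ((d : ℝ) - 1) * a ≤ b ^ 2
  · have h0 := hP 0
    have hpos : 0 ≤ (a : ℝ) * (a * d - b ^ 2) * (b ^ 2 - (d - 1) * a) :=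
      mul_nonneg (mul_nonneg ha'.le (by linarith)) (by linarith)
    have := mul_pos hc (mul_pos (mul_pos h1p h2p) h3p)
    nlinarith
  push Not at hB
  -- In the remaining case the value at 1 is compared with the product of the 1 - sᵢ, each
  -- satisfying (d - 1)(1 - sᵢ) < N by the window condition.
  have h1 := hP 1
  have hN : ∀ s : ℝ, ((d : ℝ) - 1) * (a - s) < b ^ 2 →
      (d - 1) * (1 - s) < b ^ 2 - (d - 1) * (a - 1) := fun s h => by linarith
  have hz : ∀ s : ℝ, s < 1 → 0 < ((d : ℝ) - 1) * (1 - s) := fun s h =>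
    mul_pos (by linarith) (by linarith)
  set N : ℝ := b ^ 2 - (d - 1) * (a - 1) with hNdef
  have hNpos : 0 < N := (hz _ h1l).trans (hN _ h1e)
  have hprod : ((d : ℝ) - 1) * (1 - s₁) * ((d - 1) * (1 - s₂)) * ((d - 1) * (1 - s₃)) < N * N * N :=
    mul_lt_mul'' (mul_lt_mul'' (hN _ h1e) (hN _ h2e) (hz _ h1l).le (hz _ h2l).le) (hN _ h3e)
      (mul_pos (hz _ h1l) (hz _ h2l)).le (hz _ h3l).le
  have hAkpos : 0 < ((a : ℝ) - 1) * (d * (a - 1) - b ^ 2) := by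
    have := mul_pos hc (mul_pos (mul_pos (sub_pos.2 h1l) (sub_pos.2 h2l)) (sub_pos.2 h3l))
    have h2 : 0 < ((a : ℝ) - 1) * (d * (a - 1) - b ^ 2) * N := by
      rw [hNdef]; linarith
    exact pos_of_mul_pos_left h2 hNpos.le
  have hmain : ((a : ℝ) - 1) * (d * (a - 1) - b ^ 2) * (d - 1) ^ 2 < d * N ^ 2 := by
    refine lt_of_mul_lt_mul_right ?_ hNpos.le
    calc ((a : ℝ) - 1) * (d * (a - 1) - b ^ 2) * (d - 1) ^ 2 * N
        = d * (((d : ℝ) - 1) * (1 - s₁) * ((d - 1) * (1 - s₂)) * ((d - 1) * (1 - s₃))) := by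
          rw [hNdef]; linear_combination ((d : ℝ) - 1) ^ 2 * h1
      _ < d * (N * N * N) := mul_lt_mul_of_pos_left hprod hd'
      _ = d * N ^ 2 * N := by ring
  -- With A = a - 1, D = d and k = D A - b², one has N = A - k, and the estimate becomes an
  -- inequality between integers.
  obtain ⟨A, hAz⟩ : ∃ A : ℤ, A = a - 1 := ⟨_, rfl⟩
  obtain ⟨D, hDz⟩ : ∃ D : ℤ, D = d := ⟨_, rfl⟩
  obtain ⟨k, hkz⟩ : ∃ k : ℤ, k = D * A - b ^ 2 := ⟨_, rfl⟩
  have eA : (a : ℝ) - 1 = A := by rw [hAz]; push_cast; ring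
  have eD : (d : ℝ) = D := by rw [hDz]; push_cast; ring
  have eb : (b : ℝ) ^ 2 = D * A - k := by rw [hkz]; push_cast; ring
  have eN : N = ((A - k : ℤ) : ℝ) := by rw [hNdef, eA, eD, eb]; push_cast; ring
  have ea : (a : ℝ) = A + 1 := by linarith
  rw [eN, eA, eD, eb] at hmain
  rw [eA, eD, eb] at hAkpos
  rw [eN] at hNpos
  rw [eD, ea, eb] at hB
  rw [eD] at hd2'
  rw [eD, eA, eb] at hA
  have hlt : A * k * (D - 1) ^ 2 < D * (A - k) ^ 2 := by
    have : (A : ℝ) * k * (D - 1) ^ 2 < D * ((A - k : ℤ) : ℝ) ^ 2 := by convert hmain using 2; ring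
    exact_mod_cast this
  have hAk : 0 < A * k := by
    have : (0 : ℝ) < A * k := by convert hAkpos using 2; ring
    exact_mod_cast this
  have hAk_sub : 0 < A - k := by exact_mod_cast hNpos
  have hDA : D * A - k < (D - 1) * (A + 1) := by exact_mod_cast hB
  have hk : 0 ≤ k := by
    have : (0 : ℝ) ≤ k := by linarith
    exact_mod_cast this
  exact not_mul_mul_sq_lt hlt hAk hAk_sub hDA hk

open Polynomial in
/-- The numerator of the derivative of the second auxiliary function. -/
noncomputable def nahmCubic (a b d : ℕ) : ℝ[X] :=
  (C (a : ℝ) - X) * (C (d : ℝ) * (C (a : ℝ) - X) - C ((b : ℝ) ^ 2)) *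
    (C ((b : ℝ) ^ 2) - C ((d : ℝ) - 1) * (C (a : ℝ) - X)) + C ((b : ℝ) ^ 3) * (X * (X - 1))

theorem eval_nahmCubic (a b d : ℕ) (s : ℝ) : (nahmCubic a b d).eval s =
    (a - s) * (d * (a - s) - b ^ 2) * (b ^ 2 - (d - 1) * (a - s)) + b ^ 3 * (s * (s - 1)) := by
  simp [nahmCubic]

open Polynomial in
theorem natDegree_nahmCubic_le (a b d : ℕ) : (nahmCubic a b d).natDegree ≤ 3 := by
  rw [nahmCubic]; compute_degree

theorem nahmCubic_ne_zero {a b d : ℕ} (hb : 0 < b) (hd : 0 < d) : nahmCubic a b d ≠ 0 := by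
  intro h
  have hP : ∀ s : ℝ, (a - s) * (d * (a - s) - b ^ 2) * (b ^ 2 - (d - 1) * (a - s)) +
      b ^ 3 * (s * (s - 1)) = 0 := fun s => by rw [← eval_nahmCubic, h, Polynomial.eval_zero]
  have h3 : (d : ℝ) * (d - 1) = 0 := by
    linear_combination (1 / 6) * hP 3 - (1 / 2) * hP 2 + (1 / 2) * hP 1 - (1 / 6) * hP 0
  have hb' : (0 : ℝ) < b := by exact_mod_cast hb
  have hd' : (d : ℝ) ≠ 0 := by exact_mod_cast hd.ne'
  have hd1 : (d : ℝ) = 1 := by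
    have := (mul_eq_zero.1 h3).resolve_left hd'
    linarith
  rw [hd1] at hP
  have : (b : ℝ) ^ 2 + b ^ 3 = 0 := by
    linear_combination (1 / 2) * hP 2 - hP 1 + (1 / 2) * hP 0
  have : 0 < (b : ℝ) ^ 2 + b ^ 3 := by positivity
  linarith

/-- The points of `I` at which the critical curve meets the half plane of negative `x_j`. -/
def nahmWindow (a b d : ℕ) (I : Set ℝ) : Set ℝ :=
  {s | s ∈ I ∧ s < a ∧ (b : ℝ) ^ 2 < d * (a - s) ∧ ((d : ℝ) - 1) * (a - s) < b ^ 2}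

open Polynomial in
-- Three roots in the window, with multiplicity, would exhaust the degree, so the remaining factor
-- would be a constant.
theorem zerosBoundedBy_nahmCubic {a b d : ℕ} (hb : 0 < b) (hd : 0 < d) (had : b ^ 2 < a * d) :
    ZerosBoundedBy (fun s => (nahmCubic a b d).eval s) (nahmWindow a b d (Set.Ioo 0 1)) 2 := by
  classical
  have hP0 := nahmCubic_ne_zero (a := a) hb hd
  intro S hS m hm
  refine (zerosBoundedBy_eval hP0 _ S hS m hm).trans ?_
  by_contra! hcard
  obtain ⟨T, hTdef⟩ : ∃ T, T = (nahmCubic a b d).roots.filter (· ∈ nahmWindow a b d (Set.Ioo 0 1)) :=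
    ⟨_, rfl⟩
  have hT : T ≤ (nahmCubic a b d).roots.filter (· ∈ nahmWindow a b d (Set.Ioo 0 1)) := hTdef.le
  have hT3 : T.card = 3 := by
    refine le_antisymm ?_ (by rw [hTdef]; omega)
    exact (Multiset.card_le_card (hT.trans (Multiset.filter_le _ _))).trans
      ((card_roots' _).trans (natDegree_nahmCubic_le a b d))
  obtain ⟨s₁, s₂, s₃, rfl⟩ := Multiset.card_eq_three.1 hT3
  have hroots := hT.trans (Multiset.filter_le _ _)
  obtain ⟨Q, hQ⟩ := (Multiset.prod_X_sub_C_dvd_iff_le_roots hP0 _).2 hroots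
  have hQ0 : Q ≠ 0 := by rintro rfl; simp [hP0] at hQ
  have hdeg := natDegree_nahmCubic_le a b d
  rw [hQ, natDegree_mul (Polynomial.monic_multisetProd_X_sub_C _).ne_zero hQ0,
    natDegree_multiset_prod_X_sub_C_eq_card, hT3] at hdeg
  obtain ⟨q, rfl⟩ := natDegree_eq_zero.1 (by omega : Q.natDegree = 0)
  refine nahmCubic_not_three_roots hb hd had (q := q) (s₁ := s₁) (s₂ := s₂) (s₃ := s₃) ?_ ?_
  · intro s hs
    have hs' : s ∈ ({s₁, s₂, s₃} : Multiset ℝ) := by simpa using hs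
    obtain ⟨-, ⟨h0, h1⟩, -, h2, h3⟩ := Multiset.mem_filter.1 (Multiset.mem_of_le hT hs')
    exact ⟨h0, h1, h2, h3⟩
  · intro s
    rw [← eval_nahmCubic, hQ]
    simp
    ring

/-! ### Zeros of the defect function on each branch -/

/-- `log |v|` on the curve `1 - u = u ^ a * v ^ b`, in terms of the parameter `s = u / (u - 1)`. -/
noncomputable def nahmLog (a b : ℕ) (s : ℝ) : ℝ :=
  ((a - 1) * Real.log (1 - s) - a * Real.log s) / b

/-- `log |1 - v| - log |u ^ b * v ^ d|` on the branch of `1 - u = u ^ a * v ^ b` on which `v` has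
sign `ε`, in terms of the parameter `s = u / (u - 1)`. -/
noncomputable def nahmDefect (ε : ℝ) (a b d : ℕ) (s : ℝ) : ℝ :=
  Real.log (1 - ε * Real.exp (nahmLog a b s)) - b * (Real.log s - Real.log (1 - s)) -
    d * nahmLog a b s

theorem analyticAt_nahmLog (a b : ℕ) {s : ℝ} (h0 : s ≠ 0) (h1 : s ≠ 1) :
    AnalyticAt ℝ (nahmLog a b) s := by
  have e0 : AnalyticAt ℝ (fun s : ℝ => Real.log s) s := Real.analyticAt_log_of_ne_zero h0
  have e1 : AnalyticAt ℝ (fun s : ℝ => Real.log (1 - s)) s :=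
    (Real.analyticAt_log_of_ne_zero (sub_ne_zero.2 h1.symm)).fun_comp
      (f := fun s : ℝ => 1 - s) (by fun_prop)
  exact ((analyticAt_const.mul e1).sub (analyticAt_const.mul e0)).div_const

theorem analyticAt_nahmDefect (ε : ℝ) (a b d : ℕ) {s : ℝ} (h0 : s ≠ 0) (h1 : s ≠ 1)
    (hv : ε * Real.exp (nahmLog a b s) ≠ 1) : AnalyticAt ℝ (nahmDefect ε a b d) s := by
  have e0 : AnalyticAt ℝ (fun s : ℝ => Real.log s) s := Real.analyticAt_log_of_ne_zero h0
  have e1 : AnalyticAt ℝ (fun s : ℝ => Real.log (1 - s)) s :=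
    (Real.analyticAt_log_of_ne_zero (sub_ne_zero.2 h1.symm)).fun_comp
      (f := fun s : ℝ => 1 - s) (by fun_prop)
  have e2 := analyticAt_nahmLog a b h0 h1
  have e3 : AnalyticAt ℝ (fun s => Real.log (1 - ε * Real.exp (nahmLog a b s))) s :=
    (Real.analyticAt_log_of_ne_zero (sub_ne_zero.2 hv.symm)).fun_comp
      (f := fun s => 1 - ε * Real.exp (nahmLog a b s))
      (analyticAt_const.sub (analyticAt_const.mul e2.rexp))
  exact (e3.sub (analyticAt_const.mul (e0.sub e1))).sub (analyticAt_const.mul e2)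

theorem hasDerivAt_nahmLog (a : ℕ) {b : ℕ} (hb : 0 < b) {s : ℝ} (h0 : s ≠ 0) (h1 : s ≠ 1) :
    HasDerivAt (nahmLog a b) ((a - s) / (b * (s * (s - 1)))) s := by
  have h1' : 1 - s ≠ 0 := sub_ne_zero.2 h1.symm
  have h1'' : s - 1 ≠ 0 := sub_ne_zero.2 h1
  have hb' : (b : ℝ) ≠ 0 := by exact_mod_cast hb.ne'
  have := ((((hasDerivAt_id s).const_sub 1).log h1').const_mul ((a : ℝ) - 1) |>.sub
    ((Real.hasDerivAt_log h0).const_mul (a : ℝ))).div_const (b : ℝ)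
  refine HasDerivAt.congr_deriv (f := nahmLog a b) this ?_
  simp only [id_eq]
  field_simp
  ring

theorem hasDerivAt_nahmDefect (ε : ℝ) (a : ℕ) {b : ℕ} (d : ℕ) (hb : 0 < b) {s : ℝ} (h0 : s ≠ 0)
    (h1 : s ≠ 1) (hv : ε * Real.exp (nahmLog a b s) ≠ 1) :
    HasDerivAt (nahmDefect ε a b d)
      (((a - s) * (ε * Real.exp (nahmLog a b s) / (ε * Real.exp (nahmLog a b s) - 1) - d) + b ^ 2) /
        (b * (s * (s - 1)))) s := by
  have h1' : 1 - s ≠ 0 := sub_ne_zero.2 h1.symm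
  have h1'' : s - 1 ≠ 0 := sub_ne_zero.2 h1
  have hb' : (b : ℝ) ≠ 0 := by exact_mod_cast hb.ne'
  have hv' : 1 - ε * Real.exp (nahmLog a b s) ≠ 0 := sub_ne_zero.2 hv.symm
  have hv'' : ε * Real.exp (nahmLog a b s) - 1 ≠ 0 := sub_ne_zero.2 hv
  have hl := hasDerivAt_nahmLog a hb h0 h1
  have := (((((hl.exp).const_mul ε).const_sub 1).log hv').sub
    ((((Real.hasDerivAt_log h0).sub (((hasDerivAt_id s).const_sub 1).log h1')).const_mul
      (b : ℝ)))).sub (hl.const_mul (d : ℝ))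
  refine HasDerivAt.congr_deriv (f := nahmDefect ε a b d) this ?_
  simp only [id_eq]
  generalize Real.exp (nahmLog a b s) = E at *
  field_simp
  ring

/-- Monotonicity makes the part of the negative axis with |v| < 1 an interval, as Rolle's theorem
requires. -/
theorem nahmLog_strictMonoOn {a b : ℕ} (ha : 0 < a) (hb : 0 < b) :
    StrictMonoOn (nahmLog a b) (Set.Iio 0) := by
  have hb' : (0 : ℝ) < b := by exact_mod_cast hb
  have ha' : (0 : ℝ) < a := by exact_mod_cast ha
  refine strictMonoOn_of_deriv_pos (convex_Iio 0) (fun s hs => ?_) (fun s hs => ?_)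
  · have hs : s < 0 := hs
    exact (hasDerivAt_nahmLog a hb hs.ne (by linarith)).continuousAt.continuousWithinAt
  · rw [interior_Iio] at hs
    have hs : s < 0 := hs
    rw [(hasDerivAt_nahmLog a hb hs.ne (by linarith)).deriv]
    have : 0 < s * (s - 1) := mul_pos_of_neg_of_neg hs (by linarith)
    exact div_pos (by linarith) (by positivity)

/-- In the open unit square. -/
theorem zerosBoundedBy_nahmDefect_one {a b d : ℕ} (hb : 0 < b) (had : b ^ 2 < a * d) :
    ZerosBoundedBy (nahmDefect 1 a b d) {s | s < 0 ∧ nahmLog a b s < 0} 1 := by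
  have ha : 0 < a := by rcases a.eq_zero_or_pos with rfl | h <;> simp_all
  have ha' : (0 : ℝ) < a := by exact_mod_cast ha
  have had' : (b : ℝ) ^ 2 < a * d := by exact_mod_cast had
  have hb' : (0 : ℝ) < b := by exact_mod_cast hb
  have hv : ∀ s, nahmLog a b s < 0 → 1 * Real.exp (nahmLog a b s) < 1 := fun s hs => by
    simpa using hs
  refine ZerosBoundedBy.of_deriv (n := 0) ⟨?_⟩ ?_ (zerosBoundedBy_zero ?_)
  · rintro x ⟨hx0, hx⟩ y ⟨hy0, hy⟩ z ⟨hxz, hzy⟩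
    have hz0 : z < 0 := hzy.trans_lt hy0
    exact ⟨hz0, ((nahmLog_strictMonoOn ha hb).monotoneOn hz0 hy0 hzy).trans_lt hy⟩
  · rintro s ⟨hs0, hs⟩
    exact analyticAt_nahmDefect 1 a b d hs0.ne (by linarith) (hv s hs).ne
  · rintro s ⟨hs0, hs⟩
    rw [(hasDerivAt_nahmDefect 1 a d hb hs0.ne (by linarith) (hv s hs).ne).deriv]
    have hpos : 0 < 1 * Real.exp (nahmLog a b s) := by simp [Real.exp_pos]
    have ht := div_neg_of_pos_of_neg hpos (sub_neg.2 (hv s hs))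
    set t := 1 * Real.exp (nahmLog a b s) / (1 * Real.exp (nahmLog a b s) - 1)
    have hs1 : 0 < s * (s - 1) := mul_pos_of_neg_of_neg hs0 (by linarith)
    have hd : (0 : ℝ) ≤ d := Nat.cast_nonneg d
    -- The numerator is (a - s) t + s d - (a d - b²), with t < 0, s < 0 and a d > b².
    refine (div_neg_of_neg_of_pos ?_ (by positivity)).ne
    nlinarith [mul_nonneg (neg_nonneg.2 hs0.le) hd, mul_pos (neg_pos.2 hs0) (neg_pos.2 ht),
      mul_pos ha' (neg_pos.2 ht)]

/-- The difference of `log |v|` on the first curve and on the critical curve. -/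
noncomputable def nahmCritical (a b d : ℕ) (s : ℝ) : ℝ :=
  nahmLog a b s - Real.log (d * (a - s) - b ^ 2) + Real.log (b ^ 2 - (d - 1) * (a - s))

theorem ordConnected_nahmWindow (a b d : ℕ) (hd : 0 < d) {I : Set ℝ} (hI : I.OrdConnected) :
    (nahmWindow a b d I).OrdConnected := by
  have hd' : (1 : ℝ) ≤ d := by exact_mod_cast hd
  refine ⟨?_⟩
  rintro x ⟨hxI, hxa, hx1, hx2⟩ y ⟨hyI, hya, hy1, hy2⟩ z ⟨hxz, hzy⟩
  exact ⟨hI.out hxI hyI ⟨hxz, hzy⟩, by linarith, by nlinarith, by nlinarith⟩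

theorem hasDerivAt_nahmCritical (a : ℕ) {b : ℕ} (d : ℕ) (hb : 0 < b) {s : ℝ} (h0 : s ≠ 0)
    (h1 : s ≠ 1) (h2 : (d : ℝ) * (a - s) - b ^ 2 ≠ 0)
    (h3 : (b : ℝ) ^ 2 - (d - 1) * (a - s) ≠ 0) :
    HasDerivAt (nahmCritical a b d) ((a - s) / (b * (s * (s - 1))) +
      b ^ 2 / ((d * (a - s) - b ^ 2) * (b ^ 2 - (d - 1) * (a - s)))) s := by
  have hw := (hasDerivAt_id s).const_sub (a : ℝ)
  have := ((hasDerivAt_nahmLog a hb h0 h1).sub (((hw.const_mul (d : ℝ)).sub_const _).log h2)).add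
    (((hw.const_mul ((d : ℝ) - 1)).const_sub _).log h3)
  refine HasDerivAt.congr_deriv (f := nahmCritical a b d) this ?_
  simp only [id_eq]
  -- Partial fractions: d / p + (d - 1) / r = b² / (p r) for the two logarithm arguments p and r.
  have e : (b : ℝ) ^ 2 = d * (b ^ 2 - (d - 1) * (a - s)) + (d - 1) * (d * (a - s) - b ^ 2) := by
    ring
  nth_rw 3 [e]
  generalize (d : ℝ) * (a - s) - b ^ 2 = p at *
  generalize (b : ℝ) ^ 2 - (d - 1) * (a - s) = r at *
  generalize (a - s) / (b * (s * (s - 1))) = z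
  field_simp
  ring

theorem analyticAt_nahmCritical (a b d : ℕ) {s : ℝ} (h0 : s ≠ 0)
    (h1 : s ≠ 1) (h2 : (d : ℝ) * (a - s) - b ^ 2 ≠ 0)
    (h3 : (b : ℝ) ^ 2 - (d - 1) * (a - s) ≠ 0) : AnalyticAt ℝ (nahmCritical a b d) s :=
  ((analyticAt_nahmLog a b h0 h1).sub ((Real.analyticAt_log_of_ne_zero h2).fun_comp
    (f := fun s : ℝ => (d : ℝ) * (a - s) - b ^ 2) (by fun_prop))).add
    ((Real.analyticAt_log_of_ne_zero h3).fun_comp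
    (f := fun s : ℝ => (b : ℝ) ^ 2 - (d - 1) * (a - s)) (by fun_prop))

/-- The derivative vanishes exactly where t = t₂, and t in (0, 1) forces s into the window. Applying
log (x / (1 - x)) to both sides turns t - t₂ into `nahmCritical`; this function is differentiable,
so orders of vanishing do not drop. -/
theorem zerosBoundedBy_deriv_nahmDefect {a b d n : ℕ} (hb : 0 < b) (hd : 0 < d) {I : Set ℝ}
    (hI : ∀ s ∈ I, s ≠ 0 ∧ s ≠ 1)
    (h : ZerosBoundedBy (nahmCritical a b d) (nahmWindow a b d I) n) :
    ZerosBoundedBy (deriv (nahmDefect (-1) a b d)) I n := by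
  have hb' : (0 : ℝ) < b := by exact_mod_cast hb
  have hd' : (1 : ℝ) ≤ d := by exact_mod_cast hd
  set t : ℝ → ℝ := fun s => Real.exp (nahmLog a b s) / (1 + Real.exp (nahmLog a b s)) with ht
  set t₂ : ℝ → ℝ := fun s => d - b ^ 2 / (a - s) with ht₂
  have htpos : ∀ s, 0 < t s := fun s => by have := Real.exp_pos (nahmLog a b s); positivity
  have htlt : ∀ s, t s < 1 := fun s => by
    have := Real.exp_pos (nahmLog a b s)
    rw [ht, div_lt_one (by positivity)]; linarith
  have hderiv : ∀ s, s ≠ 0 → s ≠ 1 → deriv (nahmDefect (-1) a b d) s =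
      ((a - s) * (t s - d) + b ^ 2) / (b * (s * (s - 1))) := fun s h0 h1 => by
    have hE := Real.exp_pos (nahmLog a b s)
    rw [(hasDerivAt_nahmDefect (-1) a d hb h0 h1 (by linarith)).deriv]
    have : -1 * Real.exp (nahmLog a b s) / (-1 * Real.exp (nahmLog a b s) - 1) = t s := by
      rw [ht, ← neg_div_neg_eq]; congr 1 <;> ring
    rw [this]
  refine h.of_isBigO fun s hs hzero => ?_
  obtain ⟨h0, h1⟩ := hI s hs
  have hs01 : s * (s - 1) ≠ 0 := mul_ne_zero h0 (sub_ne_zero.2 h1)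
  rw [hderiv s h0 h1, div_eq_zero_iff, or_iff_left (mul_ne_zero hb'.ne' hs01)] at hzero
  have hb2 : (0 : ℝ) < b ^ 2 := by positivity
  -- If a - s ≤ 0, then t < 1 ≤ d makes the numerator at least b² > 0.
  have hw : 0 < (a : ℝ) - s := by
    by_contra! hle
    nlinarith [htlt s]
  have e1 : (d : ℝ) * (a - s) - b ^ 2 = (a - s) * t s := by linear_combination -hzero
  have e2 : (b : ℝ) ^ 2 - (d - 1) * (a - s) = (a - s) * (1 - t s) := by
    linear_combination hzero
  have p1 : 0 < (d : ℝ) * (a - s) - b ^ 2 := e1 ▸ mul_pos hw (htpos s)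
  have p2 : 0 < (b : ℝ) ^ 2 - (d - 1) * (a - s) := e2 ▸ mul_pos hw (sub_pos.2 (htlt s))
  refine ⟨⟨hs, sub_pos.1 hw, sub_pos.1 p1, sub_pos.1 p2⟩, fun m hm => ?_⟩
  have hev : ∀ᶠ y in 𝓝 s, y ≠ 0 ∧ y ≠ 1 ∧ 0 < (a : ℝ) - y ∧ 0 < (d : ℝ) * (a - y) - b ^ 2 ∧
      0 < (b : ℝ) ^ 2 - (d - 1) * (a - y) := by
    refine (isOpen_ne.eventually_mem h0).and
      ((isOpen_ne.eventually_mem h1).and (Eventually.and ?_ (Eventually.and ?_ ?_)))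
    · exact continuousAt_const.eventually_lt (f := fun _ => (0 : ℝ)) (by fun_prop) hw
    · exact continuousAt_const.eventually_lt (f := fun _ => (0 : ℝ)) (by fun_prop) p1
    · exact continuousAt_const.eventually_lt (f := fun _ => (0 : ℝ)) (by fun_prop) p2
  have htt : t₂ s = t s := by
    simp only [ht₂]
    field_simp
    linear_combination e1
  have hlc : ContinuousAt (nahmLog a b) s := (analyticAt_nahmLog a b h0 h1).continuousAt
  have htc : ContinuousAt t s := by
    have hne : 1 + Real.exp (nahmLog a b s) ≠ 0 := by have := Real.exp_pos (nahmLog a b s); positivity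
    exact (hlc.rexp).div (continuousAt_const.add hlc.rexp) hne
  have ht₂c : ContinuousAt t₂ s :=
    continuousAt_const.sub (continuousAt_const.div (by fun_prop) hw.ne')
  have hψ : HasStrictDerivAt (fun x : ℝ => Real.log x - Real.log (1 - x))
      ((t s)⁻¹ - (1 - t s)⁻¹ * (-1)) (t s) :=
    (Real.hasStrictDerivAt_log (htpos s).ne').sub
      ((Real.hasStrictDerivAt_log (sub_pos.2 (htlt s)).ne').comp (t s)
        ((hasStrictDerivAt_id (t s)).const_sub 1))
  have hO : nahmCritical a b d =O[𝓝 s] fun y => t y - t₂ y := by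
    have hlim : Tendsto (fun y => (t y, t₂ y)) (𝓝 s) (𝓝 (t s, t s)) := by
      have := htc.tendsto.prodMk_nhds ht₂c.tendsto
      rwa [htt] at this
    refine (EventuallyEq.isBigO ?_).trans (hψ.isBigO_sub.comp_tendsto hlim)
    filter_upwards [hev] with y ⟨_, _, q1, q2, q3⟩
    have hE := Real.exp_pos (nahmLog a b y)
    have f1 : 1 - t y = 1 / (1 + Real.exp (nahmLog a b y)) := by
      simp only [ht]; field_simp; ring
    have f2 : t₂ y = (d * (a - y) - b ^ 2) / (a - y) := by simp only [ht₂]; field_simp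
    have f3 : 1 - t₂ y = (b ^ 2 - (d - 1) * (a - y)) / (a - y) := by
      simp only [ht₂]; field_simp; ring
    simp only [Function.comp]
    rw [f1, f3, f2, Real.log_div q2.ne' q1.ne', Real.log_div q3.ne' q1.ne',
      Real.log_div one_ne_zero (by positivity), ht, Real.log_div hE.ne' (by positivity),
      Real.log_exp, Real.log_one, nahmCritical]
    ring
  refine hO.trans ?_
  have hO2 : (fun y => t y - t₂ y) =O[𝓝 s] deriv (nahmDefect (-1) a b d) := by
    have hc : ContinuousAt (fun y : ℝ => b * (y * (y - 1)) / (a - y)) s :=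
      ContinuousAt.div (by fun_prop) (by fun_prop) hw.ne'
    refine (EventuallyEq.isBigO (f₂ := fun y => (b * (y * (y - 1)) / (a - y)) *
      deriv (nahmDefect (-1) a b d) y) ?_).trans ?_
    · filter_upwards [hev] with y ⟨q0, q1, q2, _, _⟩
      have := sub_ne_zero.2 q1
      rw [hderiv y q0 q1]
      simp only [ht₂]
      field_simp
      ring
    · simpa using (hc.tendsto.isBigO_one ℝ).mul
        (isBigO_refl (deriv (nahmDefect (-1) a b d)) (𝓝 s))
  exact hO2.trans hm

theorem nahmDefect_neg_one_of_nahmCritical {a b d n : ℕ} (hb : 0 < b) (hd : 0 < d) {I : Set ℝ}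
    (hIc : I.OrdConnected) (hI : ∀ s ∈ I, s ≠ 0 ∧ s ≠ 1)
    (h : ZerosBoundedBy (deriv (nahmCritical a b d)) (nahmWindow a b d I) n) :
    ZerosBoundedBy (nahmDefect (-1) a b d) I (n + 2) := by
  refine ZerosBoundedBy.of_deriv (n := n + 1) hIc (fun s hs => ?_)
    (zerosBoundedBy_deriv_nahmDefect hb hd hI
      (ZerosBoundedBy.of_deriv (ordConnected_nahmWindow a b d hd hIc) (fun s hs => ?_) h))
  · exact analyticAt_nahmDefect (-1) a b d (hI s hs).1 (hI s hs).2
      (by have := Real.exp_pos (nahmLog a b s); linarith)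
  · exact analyticAt_nahmCritical a b d (hI s hs.1).1 (hI s hs.1).2 (sub_pos.2 hs.2.2.1).ne'
      (sub_pos.2 hs.2.2.2).ne'

/-- Both terms of the derivative of `nahmCritical` are positive on the window when s (s - 1) > 0. -/
theorem zerosBoundedBy_nahmDefect_neg_one_two {a b d : ℕ} (hb : 0 < b) (hd : 0 < d) {I : Set ℝ}
    (hIc : I.OrdConnected) (hI : ∀ s ∈ I, 0 < s * (s - 1)) :
    ZerosBoundedBy (nahmDefect (-1) a b d) I 2 := by
  have hI' : ∀ s ∈ I, s ≠ 0 ∧ s ≠ 1 := fun s hs =>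
    ⟨by rintro rfl; simpa using hI _ hs, by rintro rfl; simpa using hI _ hs⟩
  refine nahmDefect_neg_one_of_nahmCritical (n := 0) hb hd hIc hI' (zerosBoundedBy_zero ?_)
  rintro s ⟨hs, h1, h2, h3⟩
  rw [(hasDerivAt_nahmCritical a d hb (hI' s hs).1 (hI' s hs).2 (sub_pos.2 h2).ne'
    (sub_pos.2 h3).ne').deriv]
  have hb' : (0 : ℝ) < b := by exact_mod_cast hb
  have e1 := div_pos (sub_pos.2 h1) (mul_pos hb' (hI s hs))
  have e2 := div_pos (pow_pos hb' 2) (mul_pos (sub_pos.2 h2) (sub_pos.2 h3))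
  exact (add_pos e1 e2).ne'

/-- On (0, 1) the two terms have opposite signs; clearing denominators gives `nahmCubic`. -/
theorem zerosBoundedBy_nahmDefect_neg_one_four {a b d : ℕ} (hb : 0 < b) (hd : 0 < d)
    (had : b ^ 2 < a * d) : ZerosBoundedBy (nahmDefect (-1) a b d) (Set.Ioo 0 1) 4 := by
  have hb' : (0 : ℝ) < b := by exact_mod_cast hb
  refine nahmDefect_neg_one_of_nahmCritical (n := 2) hb hd Set.ordConnected_Ioo
    (fun s hs => ⟨hs.1.ne', hs.2.ne⟩) ((zerosBoundedBy_nahmCubic hb hd had).of_isBigO ?_)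
  rintro s ⟨hs, h1, h2, h3⟩ -
  refine ⟨⟨hs, h1, h2, h3⟩, fun m hm => .trans ?_ hm⟩
  have hc : ContinuousAt (fun y : ℝ => b * (y * (y - 1)) * ((d * (a - y) - b ^ 2) *
    (b ^ 2 - (d - 1) * (a - y)))) s := by fun_prop
  refine (EventuallyEq.isBigO (f₂ := fun y => (b * (y * (y - 1)) * ((d * (a - y) - b ^ 2) *
    (b ^ 2 - (d - 1) * (a - y)))) * deriv (nahmCritical a b d) y) ?_).trans ?_
  · filter_upwards [(isOpen_ne.mem_nhds hs.1.ne' : ∀ᶠ y in 𝓝 s, y ≠ 0),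
      (isOpen_ne.mem_nhds hs.2.ne : ∀ᶠ y in 𝓝 s, y ≠ 1),
      continuousAt_const.eventually_lt (f := fun _ => (0 : ℝ))
        (g := fun y : ℝ => (d : ℝ) * (a - y) - b ^ 2) (by fun_prop) (sub_pos.2 h2),
      continuousAt_const.eventually_lt (f := fun _ => (0 : ℝ))
        (g := fun y : ℝ => (b : ℝ) ^ 2 - (d - 1) * (a - y)) (by fun_prop) (sub_pos.2 h3)]
      with y q0 q1 q2 q3
    have := sub_ne_zero.2 q1
    rw [eval_nahmCubic, (hasDerivAt_nahmCritical a d hb q0 q1 q2.ne' q3.ne').deriv]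
    generalize (d : ℝ) * (a - y) - b ^ 2 = p at *
    generalize (b : ℝ) ^ 2 - (d - 1) * (a - y) = r at *
    field_simp
  · simpa using (hc.tendsto.isBigO_one ℝ).mul (isBigO_refl (deriv (nahmCritical a b d)) (𝓝 s))

/-! ### From solutions to zeros of the defect function -/

section Multiplicity

open MvPolynomial

theorem one_le_intersectionMultiplicity {f g : MvPolynomial (Fin 2) ℂ} {p : Fin 2 → ℂ}
    (hf : eval p f = 0) (hg : eval p g = 0) : 1 ≤ intersectionMultiplicity f g p := by
  have hle : Ideal.span {algebraMap _ (PlaneLocalRing p) f, algebraMap _ (PlaneLocalRing p) g} ≤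
      IsLocalRing.maximalIdeal (PlaneLocalRing p) := by
    rw [← Localization.AtPrime.map_eq_maximalIdeal, Ideal.span_le]
    rintro x (rfl | rfl)
    · exact Ideal.mem_map_of_mem _ hf
    · exact Ideal.mem_map_of_mem _ hg
  have hnt : Nontrivial (PlaneLocalRing p ⧸
      Ideal.span {algebraMap _ (PlaneLocalRing p) f, algebraMap _ (PlaneLocalRing p) g}) :=
    Ideal.Quotient.nontrivial_iff.2 fun h =>
      (IsLocalRing.maximalIdeal.isMaximal _).ne_top (top_le_iff.1 (h ▸ hle))
  exact Order.one_le_iff_pos.2 Module.length_pos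

theorem intersectionMultiplicity_comm {k : Type*} [Field k] (f g : MvPolynomial (Fin 2) k)
    (p : Fin 2 → k) : intersectionMultiplicity f g p = intersectionMultiplicity g f p := by
  rw [intersectionMultiplicity, intersectionMultiplicity, Set.pair_comm]

theorem nahmMultiplicity_eq (a b d : ℕ) (x : ℝ × ℝ) : nahmMultiplicity a b d x =
    intersectionMultiplicity (nahmPolynomial 0 1 a b) (nahmPolynomial 1 0 d b)
      ![(x.1 : ℂ), (x.2 : ℂ)] := by
  rw [nahmMultiplicity, nahmPolynomial, nahmPolynomial, mul_comm (X 0 ^ b)]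

theorem eval_nahmPolynomial_ofReal {i j : Fin 2} {a b : ℕ} {p : Fin 2 → ℂ} {u v : ℝ}
    (hi : p i = u) (hj : p j = v) :
    eval p (nahmPolynomial i j a b) = ((1 - u - u ^ a * v ^ b : ℝ) : ℂ) := by
  simp [nahmPolynomial, hi, hj]

theorem one_le_nahmMultiplicity {a b d : ℕ} {x : ℝ × ℝ} (hx : IsNahmSolution a b d x) :
    1 ≤ nahmMultiplicity a b d x := by
  rw [nahmMultiplicity_eq]
  refine one_le_intersectionMultiplicity ?_ ?_
  · rw [eval_nahmPolynomial_ofReal (u := x.1) (v := x.2) rfl rfl, hx.1]; simp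
  · rw [eval_nahmPolynomial_ofReal (u := x.2) (v := x.1) rfl rfl, hx.2]; simp [mul_comm]

end Multiplicity

theorem Real.log_div_sub_one (x : ℝ) (h0 : x ≠ 0) (h1 : x ≠ 1) :
    Real.log (x / (x - 1)) = Real.log x - Real.log (1 - x) := by
  rw [Real.log_div h0 (sub_ne_zero.2 h1), ← Real.log_neg_eq_log (x - 1), neg_sub]

theorem Real.log_one_sub_div_sub_one (x : ℝ) (h1 : x ≠ 1) :
    Real.log (1 - x / (x - 1)) = -Real.log (1 - x) := by
  have : x - 1 ≠ 0 := sub_ne_zero.2 h1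
  have h : 1 - x / (x - 1) = (1 - x)⁻¹ := by
    have : 1 - x ≠ 0 := sub_ne_zero.2 h1.symm
    field_simp
    ring
  rw [h, Real.log_inv]

/-- `Real.log` sees only absolute values, so one formula serves all quadrants. -/
theorem nahmLog_eq_log {a b : ℕ} (hb : 0 < b) {u v : ℝ} (hu0 : u ≠ 0) (hu1 : u ≠ 1) (hv0 : v ≠ 0)
    (h : 1 - u = u ^ a * v ^ b) : nahmLog a b (u / (u - 1)) = Real.log v := by
  have hb' : (b : ℝ) ≠ 0 := by exact_mod_cast hb.ne'
  have hlog := congrArg Real.log h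
  rw [Real.log_mul (pow_ne_zero _ hu0) (pow_ne_zero _ hv0), Real.log_pow, Real.log_pow] at hlog
  rw [nahmLog, Real.log_div_sub_one u hu0 hu1, Real.log_one_sub_div_sub_one u hu1,
    div_eq_iff hb']
  linear_combination hlog

/-- The intersection multiplicity at a real solution is bounded by the order of vanishing of
`nahmDefect`. -/
theorem nahmDefect_isBigO {i j : Fin 2} (hij : i ≠ j) {a b d : ℕ} (hb : 0 < b) {p : Fin 2 → ℂ}
    {ε u v : ℝ} (hi : p i = u) (hj : p j = v) (hu0 : u ≠ 0) (hu1 : u ≠ 1) (hv0 : v ≠ 0)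
    (hv1 : v ≠ 1) (hε : v = ε * |v|) (h1 : 1 - u = u ^ a * v ^ b) (h2 : 1 - v = v ^ d * u ^ b)
    {m : ℕ}
    (hm : (m : ℕ∞) ≤ intersectionMultiplicity (nahmPolynomial i j a b) (nahmPolynomial j i d b) p) :
    nahmDefect ε a b d =O[𝓝 (u / (u - 1))] fun x => (x - u / (u - 1)) ^ m := by
  have hlog := nahmLog_eq_log hb hu0 hu1 hv0 h1
  have hb' : (b : ℝ) ≠ 0 := by exact_mod_cast hb.ne'
  have hu1' : u - 1 ≠ 0 := sub_ne_zero.2 hu1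
  have hs0 : u / (u - 1) ≠ 0 := div_ne_zero hu0 hu1'
  have hs1 : u / (u - 1) ≠ 1 := by rw [Ne, div_eq_one_iff_eq hu1']; linarith
  -- The map x ↦ x / (x - 1) is an involution.
  have hUs : u / (u - 1) / (u / (u - 1) - 1) = u := by
    have : u / (u - 1) - 1 = 1 / (u - 1) := by field_simp; ring
    rw [this]
    field_simp
  set s := u / (u - 1) with hs
  have hε0 : ε ≠ 0 := by
    rintro rfl
    exact hv0 (by rw [hε, zero_mul])
  have hε2 : |ε| = 1 := by
    have := congrArg abs hε
    rw [abs_mul, abs_abs] at this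
    exact (mul_eq_right₀ (abs_pos.2 hv0).ne').1 this.symm
  set U : ℝ → ℝ := fun x => x / (x - 1) with hU
  set V : ℝ → ℝ := fun x => ε * Real.exp (nahmLog a b x) with hV
  have hUs' : U s = u := hUs
  have hVs : V s = v := by
    simp only [hV]
    rw [hlog, Real.exp_log_eq_abs hv0, ← hε]
  have hVne : ∀ x, V x ≠ 0 := fun x => mul_ne_zero hε0 (Real.exp_pos _).ne'
  have hlogV : ∀ x, Real.log (V x) = nahmLog a b x := fun x => by
    rw [← Real.log_abs, hV, abs_mul, hε2, one_mul, Real.abs_exp, Real.log_exp]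
  have hUd : DifferentiableAt ℝ U s :=
    DifferentiableAt.div (by fun_prop) (by fun_prop) (sub_ne_zero.2 hs1)
  have hUc : ContinuousAt U s := hUd.continuousAt
  have hVc : ContinuousAt V s :=
    continuousAt_const.mul (analyticAt_nahmLog a b hs0 hs1).continuousAt.rexp
  have hev : ∀ᶠ x in 𝓝 s, x ≠ 0 ∧ x ≠ 1 ∧ V x ≠ 1 :=
    (isOpen_ne.eventually_mem hs0).and ((isOpen_ne.eventually_mem hs1).and
      (hVc.eventually_ne (hVs ▸ hv1)))
  have hUne : ∀ x, x ≠ 0 → x ≠ 1 → U x ≠ 0 ∧ 1 - U x ≠ 0 := fun x h0 h1 => by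
    have := sub_ne_zero.2 h1
    refine ⟨div_ne_zero h0 this, ?_⟩
    rw [sub_ne_zero, ne_comm, hU, Ne, div_eq_one_iff_eq this]
    linarith
  -- Logarithms give only that the ratio of the two sides is ±1; it equals 1 at s and so stays
  -- positive nearby by continuity.
  have hcurve : ∀ᶠ x in 𝓝 s, 1 - U x - U x ^ a * V x ^ b = 0 := by
    have hc : ContinuousAt (fun x => U x ^ a * V x ^ b / (1 - U x)) s :=
      ((hUc.pow a).mul (hVc.pow b)).div (continuousAt_const.sub hUc)
        (by rw [hUs']; exact sub_ne_zero.2 hu1.symm)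
    have hval : U s ^ a * V s ^ b / (1 - U s) = 1 := by
      rw [hUs', hVs, ← h1, div_self (sub_ne_zero.2 hu1.symm)]
    filter_upwards [hev, continuousAt_const.eventually_lt (f := fun _ => (0 : ℝ)) hc
      (by rw [hval]; exact one_pos)] with x ⟨q0, q1, _⟩ hpos
    obtain ⟨q2, q3⟩ := hUne x q0 q1
    have hl : Real.log (U x ^ a * V x ^ b / (1 - U x)) = 0 := by
      rw [Real.log_div (mul_ne_zero (pow_ne_zero _ q2) (pow_ne_zero _ (hVne x))) q3,
        Real.log_mul (pow_ne_zero _ q2) (pow_ne_zero _ (hVne x)), Real.log_pow, Real.log_pow, hlogV,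
        hU, Real.log_div_sub_one x q0 q1, Real.log_one_sub_div_sub_one x q1, nahmLog]
      field_simp
      ring
    have := Real.eq_one_of_pos_of_log_eq_zero hpos hl
    rw [div_eq_one_iff_eq q3] at this
    linarith
  set γ : ℝ → Fin 2 → ℂ := fun x k => if k = i then (U x : ℂ) else (V x : ℂ) with hγ
  have hγi : ∀ x, γ x i = U x := fun x => by simp [hγ]
  have hγj : ∀ x, γ x j = V x := fun x => by simp [hγ, hij.symm]
  have hγc : ContinuousAt γ s := by
    refine continuousAt_pi.2 fun k => ?_
    by_cases hk : k = i
    · simpa [hγ, hk, Function.comp_def] using Complex.continuous_ofReal.continuousAt.comp hUc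
    · simpa [hγ, hk, Function.comp_def] using Complex.continuous_ofReal.continuousAt.comp hVc
  have hγs : γ s = p := by
    funext k
    by_cases hk : k = i
    · rw [hk, hγi, hi, hUs']
    · have hkj : k = j := by omega
      rw [hkj, hγj, hj, hVs]
  have hO := eval_isBigO_of_le_intersectionMultiplicity hij hb (by rw [hi]; exact_mod_cast hu0)
    (by rw [hj]; exact_mod_cast hv0) hm hγc hγs
    (hcurve.mono fun x hx => by rw [eval_nahmPolynomial_ofReal (hγi x) (hγj x), hx]; simp)
  have hO1 : (fun x => 1 - V x - V x ^ d * U x ^ b) =O[𝓝 s] fun x => (x - s) ^ m := by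
    have e1 : (fun x => 1 - V x - V x ^ d * U x ^ b) =O[𝓝 s] fun x => (U x - U s) ^ m := by
      refine IsBigO.of_norm_norm ?_
      refine hO.norm_norm.congr_left (fun x => ?_) |>.congr_right fun x => ?_
      · rw [eval_nahmPolynomial_ofReal (hγj x) (hγi x), Complex.norm_real]
      · rw [hγi, hi, hUs', ← Complex.ofReal_sub, ← Complex.ofReal_pow, Complex.norm_real]
    exact e1.trans (hUd.isBigO_sub.pow m)
  refine IsBigO.trans ?_ hO1
  have hv1' : 1 - v ≠ 0 := sub_ne_zero.2 hv1.symm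
  have hc1 : ContinuousAt (fun x => 1 - V x) s := continuousAt_const.sub hVc
  have hlim : Tendsto (fun x => V x ^ d * U x ^ b / (1 - V x)) (𝓝 s) (𝓝 1) := by
    have : Tendsto (fun x => V x ^ d * U x ^ b / (1 - V x)) (𝓝 s)
        (𝓝 (V s ^ d * U s ^ b / (1 - V s))) :=
      (((hVc.pow d).mul (hUc.pow b)).div hc1 (by rw [hVs]; exact hv1')).tendsto
    rwa [hVs, hUs', ← h2, div_self hv1'] at this
  -- `nahmDefect` is minus the log of the ratio of the two sides of the second equation, and log is
  -- differentiable at 1.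
  have hO2 := (Real.hasDerivAt_log one_ne_zero).isBigO_sub.comp_tendsto hlim
  have hO3 : nahmDefect ε a b d =O[𝓝 s] fun x => V x ^ d * U x ^ b / (1 - V x) - 1 := by
    refine IsBigO.trans (EventuallyEq.isBigO ?_) hO2.neg_left
    filter_upwards [hev] with x ⟨q0, q1, q4⟩
    obtain ⟨q2, -⟩ := hUne x q0 q1
    simp only [Function.comp]
    rw [Real.log_div (mul_ne_zero (pow_ne_zero _ (hVne x)) (pow_ne_zero _ q2))
      (sub_ne_zero.2 q4.symm), Real.log_mul (pow_ne_zero _ (hVne x)) (pow_ne_zero _ q2),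
      Real.log_pow, Real.log_pow, hlogV, hU, Real.log_div_sub_one x q0 q1, Real.log_one, nahmDefect]
    ring
  refine hO3.trans ((EventuallyEq.isBigO (f₂ := fun x => (-(1 - V x)⁻¹) *
    (1 - V x - V x ^ d * U x ^ b)) ?_).trans ?_)
  · filter_upwards [hev] with x ⟨_, _, q4⟩
    have := sub_ne_zero.2 q4.symm
    field_simp
    ring
  · simpa using ((hc1.inv₀ (by simpa only [hVs] using hv1')).neg.tendsto.isBigO_one ℝ).mul
      (isBigO_refl (fun x => 1 - V x - V x ^ d * U x ^ b) (𝓝 s))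

theorem IsNahmSolution.ne {a b d : ℕ} (ha : 0 < a) (hd : 0 < d) {x : ℝ × ℝ}
    (hx : IsNahmSolution a b d x) : x.1 ≠ 0 ∧ x.1 ≠ 1 ∧ x.2 ≠ 0 ∧ x.2 ≠ 1 := by
  obtain ⟨u, v⟩ := x
  obtain ⟨h1, h2⟩ := hx
  simp only at *
  have hu : u ≠ 0 := by rintro rfl; simp [ha.ne'] at h1
  have hv : v ≠ 0 := by rintro rfl; simp [hd.ne'] at h2
  refine ⟨hu, ?_, hv, ?_⟩
  · rintro rfl
    exact pow_ne_zero b hv (by simpa using h1.symm)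
  · rintro rfl
    exact pow_ne_zero b hu (by simpa using h2.symm)

/-! ### Counting solutions by quadrant -/

/-- The solutions in the region `R`, counted with multiplicity, number at most `n`. -/
def SolutionsBoundedBy (a b d : ℕ) (R : Set (ℝ × ℝ)) (n : ℕ) : Prop :=
  ∀ S : Finset (ℝ × ℝ), (∀ x ∈ S, IsNahmSolution a b d x ∧ x ∈ R) → ∀ m : ℝ × ℝ → ℕ,
    (∀ x ∈ S, (m x : ℕ∞) ≤ nahmMultiplicity a b d x) → ∑ x ∈ S, m x ≤ n

namespace SolutionsBoundedBy

variable {a b d : ℕ} {R R' : Set (ℝ × ℝ)} {n n' : ℕ}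

theorem mono (h : SolutionsBoundedBy a b d R' n)
    (hR : ∀ x, IsNahmSolution a b d x → x ∈ R → x ∈ R') : SolutionsBoundedBy a b d R n :=
  fun S hS => h S fun x hx => ⟨(hS x hx).1, hR x (hS x hx).1 (hS x hx).2⟩

theorem union (h : SolutionsBoundedBy a b d R n) (h' : SolutionsBoundedBy a b d R' n') :
    SolutionsBoundedBy a b d (R ∪ R') (n + n') := by
  classical
  intro S hS m hm
  rw [← Finset.sum_filter_add_sum_filter_not S (· ∈ R)]
  refine add_le_add (h _ (fun x hx => ?_) m fun x hx => hm x (Finset.mem_filter.1 hx).1)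
    (h' _ (fun x hx => ?_) m fun x hx => hm x (Finset.mem_filter.1 hx).1)
  · exact ⟨(hS x (Finset.mem_filter.1 hx).1).1, (Finset.mem_filter.1 hx).2⟩
  · exact ⟨(hS x (Finset.mem_filter.1 hx).1).1,
      (hS x (Finset.mem_filter.1 hx).1).2.resolve_left (Finset.mem_filter.1 hx).2⟩

theorem of_zerosBoundedBy {f : ℝ → ℝ} {I : Set ℝ} (hf : ZerosBoundedBy f I n) (τ : ℝ × ℝ → ℝ)
    (hτ : Set.InjOn τ {x | IsNahmSolution a b d x ∧ x ∈ R})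
    (h : ∀ x, IsNahmSolution a b d x → x ∈ R → τ x ∈ I ∧ ∀ m : ℕ,
      (m : ℕ∞) ≤ nahmMultiplicity a b d x → f =O[𝓝 (τ x)] fun y => (y - τ x) ^ m) :
    SolutionsBoundedBy a b d R n := by
  classical
  intro S hS m hm
  have hinj : Set.InjOn τ S := hτ.mono hS
  have hinv : ∀ x ∈ S, Function.invFunOn τ S (τ x) = x := fun x hx => hinj.leftInvOn_invFunOn hx
  have := hf (S.image τ) (fun y hy => ?_) (fun y => m (Function.invFunOn τ S y)) fun y hy => ?_
  · rw [Finset.sum_image hinj] at this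
    rwa [Finset.sum_congr rfl fun x hx => by rw [hinv x hx]] at this
  · obtain ⟨x, hx, rfl⟩ := Finset.mem_image.1 hy
    exact (h x (hS x hx).1 (hS x hx).2).1
  · obtain ⟨x, hx, rfl⟩ := Finset.mem_image.1 hy
    rw [hinv x hx]
    exact (h x (hS x hx).1 (hS x hx).2).2 _ (hm x hx)

end SolutionsBoundedBy

theorem div_sub_one_injective {u u' : ℝ} (hu : u ≠ 1) (hu' : u' ≠ 1)
    (h : u / (u - 1) = u' / (u' - 1)) : u = u' := by
  rw [div_eq_div_iff (sub_ne_zero.2 hu) (sub_ne_zero.2 hu')] at h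
  linarith

theorem eq_of_log_eq_of_sign {ε v v' : ℝ} (hv0 : v ≠ 0) (hv0' : v' ≠ 0) (hv : v = ε * |v|)
    (hv' : v' = ε * |v'|) (h : Real.log v = Real.log v') : v = v' := by
  rw [hv, hv', ← Real.exp_log_eq_abs hv0, ← Real.exp_log_eq_abs hv0', h]

/-- Zeros of `nahmDefect` count the solutions, with the first unknown as parameter. -/
theorem solutionsBoundedBy_fst {a b d n : ℕ} (ha : 0 < a) (hb : 0 < b) (hd : 0 < d) {ε : ℝ}
    {I : Set ℝ} (h : ZerosBoundedBy (nahmDefect ε a b d) I n) {R : Set (ℝ × ℝ)}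
    (hR : ∀ x ∈ R, x.2 = ε * |x.2|)
    (hI : ∀ x, IsNahmSolution a b d x → x ∈ R → x.1 / (x.1 - 1) ∈ I) :
    SolutionsBoundedBy a b d R n := by
  refine .of_zerosBoundedBy h (fun x => x.1 / (x.1 - 1)) ?_ fun x hx hxR => ⟨hI x hx hxR, ?_⟩
  · rintro ⟨u, v⟩ ⟨hx, hxR⟩ ⟨u', v'⟩ ⟨hx', hxR'⟩ heq
    obtain ⟨hu0, hu1, hv0, hv1⟩ := hx.ne ha hd
    obtain ⟨hu0', hu1', hv0', hv1'⟩ := hx'.ne ha hd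
    have hu := div_sub_one_injective hu1 hu1' heq
    simp only at hu
    subst hu
    have := (nahmLog_eq_log hb hu0 hu1 hv0 hx.1).symm.trans
      (nahmLog_eq_log hb hu0' hu1' hv0' hx'.1)
    rw [Prod.mk.injEq]
    exact ⟨rfl, eq_of_log_eq_of_sign hv0 hv0' (hR _ hxR) (hR _ hxR') this⟩
  · intro m hm
    obtain ⟨hu0, hu1, hv0, hv1⟩ := hx.ne ha hd
    rw [nahmMultiplicity_eq] at hm
    exact nahmDefect_isBigO zero_ne_one hb rfl rfl hu0 hu1 hv0 hv1 (hR x hxR) hx.1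
      (hx.2.trans (mul_comm _ _)) hm

/-- Zeros of `nahmDefect` count the solutions, with the second unknown as parameter. -/
theorem solutionsBoundedBy_snd {a b d n : ℕ} (ha : 0 < a) (hb : 0 < b) (hd : 0 < d) {ε : ℝ}
    {I : Set ℝ} (h : ZerosBoundedBy (nahmDefect ε d b a) I n) {R : Set (ℝ × ℝ)}
    (hR : ∀ x ∈ R, x.1 = ε * |x.1|)
    (hI : ∀ x, IsNahmSolution a b d x → x ∈ R → x.2 / (x.2 - 1) ∈ I) :
    SolutionsBoundedBy a b d R n := by
  refine .of_zerosBoundedBy h (fun x => x.2 / (x.2 - 1)) ?_ fun x hx hxR => ⟨hI x hx hxR, ?_⟩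
  · rintro ⟨u, v⟩ ⟨hx, hxR⟩ ⟨u', v'⟩ ⟨hx', hxR'⟩ heq
    obtain ⟨hu0, hu1, hv0, hv1⟩ := hx.ne ha hd
    obtain ⟨hu0', hu1', hv0', hv1'⟩ := hx'.ne ha hd
    have hv := div_sub_one_injective hv1 hv1' heq
    simp only at hv
    subst hv
    have := (nahmLog_eq_log hb hv0 hv1 hu0 (hx.2.trans (mul_comm _ _))).symm.trans
      (nahmLog_eq_log hb hv0' hv1' hu0' (hx'.2.trans (mul_comm _ _)))
    rw [Prod.mk.injEq]
    exact ⟨eq_of_log_eq_of_sign hu0 hu0' (hR _ hxR) (hR _ hxR') this, rfl⟩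
  · intro m hm
    obtain ⟨hu0, hu1, hv0, hv1⟩ := hx.ne ha hd
    rw [nahmMultiplicity_eq, intersectionMultiplicity_comm] at hm
    exact nahmDefect_isBigO one_ne_zero hb rfl rfl hv0 hv1 hu0 hu1 (hR x hxR)
      (hx.2.trans (mul_comm _ _)) hx.1 hm

theorem eq_neg_one_mul_abs {v : ℝ} (hv : v < 0) : v = -1 * |v| := by
  rw [abs_of_neg hv]; ring

/-- The sign condition on a solution with `v < 0 < u`. -/
theorem lt_one_of_even_or_one_lt_of_odd {a b : ℕ} {u v : ℝ} (hu : 0 < u) (hv : v < 0)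
    (h : 1 - u = u ^ a * v ^ b) : (Even b → u < 1) ∧ (Odd b → 1 < u) := by
  constructor
  · intro hb
    have := mul_pos (pow_pos hu a) (hb.pow_pos hv.ne)
    linarith
  · intro hb
    have := mul_neg_of_pos_of_neg (pow_pos hu a) (hb.pow_neg hv)
    linarith

/-- The interval depends on the parity of b: s < 0 for even b and s > 1 for odd b. Either way s (s -
1) > 0. -/
theorem exists_zerosBoundedBy_nahmDefect_neg_one {a b d : ℕ} (hb : 0 < b) (hd : 0 < d) :
    ∃ I : Set ℝ, ZerosBoundedBy (nahmDefect (-1) a b d) I 2 ∧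
      ∀ u v : ℝ, 0 < u → v < 0 → 1 - u = u ^ a * v ^ b → u / (u - 1) ∈ I := by
  rcases b.even_or_odd with hb2 | hb2
  · refine ⟨Set.Iio 0, zerosBoundedBy_nahmDefect_neg_one_two hb hd Set.ordConnected_Iio
      fun s hs => ?_, fun u v hu hv h => ?_⟩
    · have hs : s < 0 := hs
      exact mul_pos_of_neg_of_neg hs (by linarith)
    · have := (lt_one_of_even_or_one_lt_of_odd hu hv h).1 hb2
      exact div_neg_of_pos_of_neg hu (by linarith)
  · refine ⟨Set.Ioi 1, zerosBoundedBy_nahmDefect_neg_one_two hb hd Set.ordConnected_Ioi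
      fun s hs => ?_, fun u v hu hv h => ?_⟩
    · have hs : 1 < s := hs
      exact mul_pos (by linarith) (by linarith)
    · have := (lt_one_of_even_or_one_lt_of_odd hu hv h).2 hb2
      exact Set.mem_Ioi.2 ((one_lt_div (sub_pos.2 this)).2 (sub_one_lt u))

section Regions

variable {a b d : ℕ}

theorem pos_of_sq_lt_mul (had : b ^ 2 < a * d) : 0 < a ∧ 0 < d :=
  CanonicallyOrderedAdd.mul_pos.1 ((Nat.zero_le _).trans_lt had)

theorem IsNahmSolution.lt_one {x : ℝ × ℝ} (hx : IsNahmSolution a b d x) (h1 : 0 < x.1)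
    (h2 : 0 < x.2) : x.1 < 1 ∧ x.2 < 1 := by
  have e1 := mul_pos (pow_pos h1 a) (pow_pos h2 b)
  have e2 := mul_pos (pow_pos h1 b) (pow_pos h2 d)
  rw [← hx.1] at e1
  rw [← hx.2] at e2
  exact ⟨by linarith, by linarith⟩

theorem solutionsBoundedBy_pos_pos (hb : 0 < b) (had : b ^ 2 < a * d) :
    SolutionsBoundedBy a b d {x | 0 < x.1 ∧ 0 < x.2} 1 := by
  obtain ⟨ha, hd⟩ := pos_of_sq_lt_mul had
  refine solutionsBoundedBy_fst ha hb hd (zerosBoundedBy_nahmDefect_one hb had)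
    (fun x hx => by rw [abs_of_pos hx.2, one_mul]) fun x hx hxR => ?_
  obtain ⟨h1, h2⟩ := hx.lt_one hxR.1 hxR.2
  refine ⟨div_neg_of_pos_of_neg hxR.1 (by linarith), ?_⟩
  rw [nahmLog_eq_log hb hxR.1.ne' h1.ne hxR.2.ne' hx.1]
  exact Real.log_neg hxR.2 h2

theorem solutionsBoundedBy_pos_neg (hb : 0 < b) (had : b ^ 2 < a * d) :
    SolutionsBoundedBy a b d {x | 0 < x.1 ∧ x.2 < 0} 2 := by
  obtain ⟨ha, hd⟩ := pos_of_sq_lt_mul had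
  obtain ⟨I, hI, h⟩ := exists_zerosBoundedBy_nahmDefect_neg_one (a := a) hb hd
  exact solutionsBoundedBy_fst ha hb hd hI (fun x hx => eq_neg_one_mul_abs hx.2)
    fun x hx hxR => h x.1 x.2 hxR.1 hxR.2 hx.1

theorem solutionsBoundedBy_neg_pos (hb : 0 < b) (had : b ^ 2 < a * d) :
    SolutionsBoundedBy a b d {x | x.1 < 0 ∧ 0 < x.2} 2 := by
  obtain ⟨ha, hd⟩ := pos_of_sq_lt_mul had
  obtain ⟨I, hI, h⟩ := exists_zerosBoundedBy_nahmDefect_neg_one (a := d) hb ha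
  exact solutionsBoundedBy_snd ha hb hd hI (fun x hx => eq_neg_one_mul_abs hx.1)
    fun x hx hxR => h x.2 x.1 hxR.2 hxR.1 (hx.2.trans (mul_comm _ _))

theorem solutionsBoundedBy_neg_neg (hb : 0 < b) (had : b ^ 2 < a * d) :
    SolutionsBoundedBy a b d {x | x.1 < 0 ∧ x.2 < 0} 4 := by
  obtain ⟨ha, hd⟩ := pos_of_sq_lt_mul had
  refine solutionsBoundedBy_fst ha hb hd (zerosBoundedBy_nahmDefect_neg_one_four hb hd had)
    (fun x hx => eq_neg_one_mul_abs hx.2) fun x _ hxR => ?_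
  have h1 : x.1 < 0 := hxR.1
  exact ⟨div_pos_of_neg_of_neg h1 (by linarith), (div_lt_one_of_neg (by linarith)).2 (by linarith)⟩

theorem solutionsBoundedBy_univ (hb : 0 < b) (had : b ^ 2 < a * d) :
    SolutionsBoundedBy a b d Set.univ 9 := by
  obtain ⟨ha, hd⟩ := pos_of_sq_lt_mul had
  refine ((((solutionsBoundedBy_pos_pos hb had).union (solutionsBoundedBy_pos_neg hb had)).union
    (solutionsBoundedBy_neg_pos hb had)).union (solutionsBoundedBy_neg_neg hb had)).mono ?_
  intro x hx _
  obtain ⟨h1, -, h2, -⟩ := hx.ne ha hd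
  rcases h1.lt_or_gt with h1 | h1 <;> rcases h2.lt_or_gt with h2 | h2 <;> simp [h1, h2, h1.not_gt, h2.not_gt]

/-- Take c with c^a = 1 - c. On [c, 1] the first equation defines v, going from 1 to 0, and 1 - v -
x^b v^d changes from -c^b to 1. -/
theorem exists_isNahmSolution_Ioo (ha : 0 < a) (hb : 0 < b) (hd : 0 < d) :
    ∃ x : ℝ × ℝ, IsNahmSolution a b d x ∧ x.1 ∈ Set.Ioo (0 : ℝ) 1 ∧ x.2 ∈ Set.Ioo (0 : ℝ) 1 := by
  obtain ⟨c, hc, hc0⟩ : (0 : ℝ) ∈ (fun t : ℝ => t ^ a - (1 - t)) '' Set.Ioo 0 1 :=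
    intermediate_value_Ioo zero_le_one (by fun_prop) (by simp [ha.ne'])
  have hb' : (0 : ℝ) < b := by exact_mod_cast hb
  set v : ℝ → ℝ := fun x => ((1 - x) / x ^ a) ^ ((b : ℝ)⁻¹) with hv
  have hvc : ContinuousOn v (Set.Icc c 1) := by
    refine ContinuousOn.rpow_const (ContinuousOn.div (by fun_prop) (by fun_prop) fun x hx => ?_)
      fun x _ => Or.inr (by positivity)
    exact pow_ne_zero _ (hc.1.trans_le hx.1).ne'
  have hvcc : v c = 1 := by
    have : 1 - c = c ^ a := by linarith
    simp only [hv]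
    rw [this, div_self (pow_ne_zero _ hc.1.ne'), Real.one_rpow]
  have hv1 : v 1 = 0 := by
    simp only [hv]
    rw [sub_self, zero_div, Real.zero_rpow (by positivity)]
  obtain ⟨x, hx, hx0⟩ : (0 : ℝ) ∈ (fun t : ℝ => 1 - v t - t ^ b * v t ^ d) '' Set.Ioo c 1 := by
    refine intermediate_value_Ioo hc.2.le (by fun_prop) ⟨?_, ?_⟩
    · simp only [hvcc, one_pow]
      have := pow_pos hc.1 b
      linarith
    · simp [hv1, hd.ne']
  have hx1 : 0 < x := hc.1.trans hx.1
  have hpow : 0 < x ^ a := pow_pos hx1 a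
  have hq : 0 < (1 - x) / x ^ a := div_pos (by linarith [hx.2]) hpow
  have hq1 : (1 - x) / x ^ a < 1 := by
    rw [div_lt_one hpow]
    have : c ^ a < x ^ a := pow_lt_pow_left₀ hx.1 hc.1.le ha.ne'
    have : 1 - c = c ^ a := by linarith
    linarith [hx.1]
  refine ⟨(x, v x), ⟨?_, by simp only at hx0 ⊢; linarith⟩, ⟨hx1, hx.2⟩,
    Real.rpow_pos_of_pos hq _, Real.rpow_lt_one hq.le hq1 (by positivity)⟩
  simp only [hv]
  rw [Real.rpow_inv_natCast_pow hq.le hb.ne']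
  field_simp

end Regions

/-! ### Finiteness and the final count -/

theorem SolutionsBoundedBy.finite {a b d n : ℕ} {R : Set (ℝ × ℝ)}
    (h : SolutionsBoundedBy a b d R n) : {x | IsNahmSolution a b d x ∧ x ∈ R}.Finite := by
  by_contra hinf
  obtain ⟨S, hS, hcard⟩ := Set.Infinite.exists_subset_card_eq hinf (n + 1)
  have := h S hS (fun _ => 1) fun x hx => by exact_mod_cast one_le_nahmMultiplicity (hS hx).1
  simp only [Finset.sum_const, smul_eq_mul, mul_one] at this
  omega

theorem SolutionsBoundedBy.sum_le {a b d n : ℕ} {R : Set (ℝ × ℝ)}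
    (h : SolutionsBoundedBy a b d R n) {S : Finset (ℝ × ℝ)}
    (hS : ∀ x ∈ S, IsNahmSolution a b d x ∧ x ∈ R) :
    ∑ x ∈ S, nahmMultiplicity a b d x ≤ n := by
  -- Multiplicities may a priori be infinite, so they are cut off at n + 1; the bound n then shows
  -- that no cut took place.
  set m : ℝ × ℝ → ℕ := fun x => (min (nahmMultiplicity a b d x) (n + 1 : ℕ)).toNat with hm
  have hmc : ∀ x, (m x : ℕ∞) = min (nahmMultiplicity a b d x) (n + 1 : ℕ) := fun x =>
    ENat.natCast_toNat (ne_top_of_le_ne_top (ENat.natCast_ne_top _) (min_le_right _ _))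
  have hsum := h S hS m fun x _ => (hmc x).trans_le (min_le_left _ _)
  have hle : ∀ x ∈ S, nahmMultiplicity a b d x = m x := fun x hx => by
    have h1 : m x ≤ n := (Finset.single_le_sum (fun _ _ => Nat.zero_le _) hx).trans hsum
    rw [hmc, eq_comm, min_eq_left_iff]
    by_contra! hlt
    have h2 := hmc x
    rw [min_eq_right hlt.le] at h2
    have : m x = n + 1 := by exact_mod_cast h2
    omega
  rw [Finset.sum_congr rfl hle]
  exact_mod_cast hsum

theorem lemma2p4 (a b d : ℕ) (hb : 0 < b)
    (hA : (!![(a : ℝ), (b : ℝ); (b : ℝ), (d : ℝ)] : Matrix (Fin 2) (Fin 2) ℝ).PosDef) :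
    (∃ S : Finset (ℝ × ℝ), (∀ x : ℝ × ℝ, x ∈ S ↔ IsNahmSolution a b d x) ∧
      ∑ x ∈ S, nahmMultiplicity a b d x ≤ 9) ∧
    (∃! x : ℝ × ℝ, IsNahmSolution a b d x ∧ x.1 ∈ Set.Ioo (0 : ℝ) 1 ∧ x.2 ∈ Set.Ioo (0 : ℝ) 1) ∧
    (∀ x : ℝ × ℝ, IsNahmSolution a b d x → x.1 ∈ Set.Ioo (0 : ℝ) 1 → x.2 ∈ Set.Ioo (0 : ℝ) 1 →
      nahmMultiplicity a b d x = 1) := by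
  have had : b ^ 2 < a * d := by
    have h := hA.det_pos
    rw [Matrix.det_fin_two_of] at h
    have : (b : ℝ) ^ 2 < a * d := by linarith
    exact_mod_cast this
  obtain ⟨ha, hd⟩ := pos_of_sq_lt_mul had
  have huniv := solutionsBoundedBy_univ hb had
  have hsq := solutionsBoundedBy_pos_pos hb had
  refine ⟨⟨huniv.finite.toFinset, by simp, huniv.sum_le fun x hx => by simpa using hx⟩, ?_, ?_⟩
  · obtain ⟨x, hx, h1, h2⟩ := exists_isNahmSolution_Ioo ha hb hd
    refine ⟨x, ⟨hx, h1, h2⟩, ?_⟩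
    rintro y ⟨hy, h1', h2'⟩
    by_contra hne
    have hS : ∀ z ∈ ({y, x} : Finset (ℝ × ℝ)), IsNahmSolution a b d z ∧ z ∈
        {x : ℝ × ℝ | 0 < x.1 ∧ 0 < x.2} := by
      simp only [Finset.mem_insert, Finset.mem_singleton]
      rintro z (rfl | rfl)
      · exact ⟨hy, h1'.1, h2'.1⟩
      · exact ⟨hx, h1.1, h2.1⟩
    have := hsq _ hS (fun _ => 1) fun z hz => by
      exact_mod_cast one_le_nahmMultiplicity (hS z hz).1
    simp [Finset.card_pair hne] at this
  · intro x hx h1 h2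
    refine le_antisymm ?_ (one_le_nahmMultiplicity hx)
    have := hsq.sum_le (S := {x}) fun y hy => by
      rw [Finset.mem_singleton.1 hy]; exact ⟨hx, h1.1, h2.1⟩
    simpa using this
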